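/- Let $n\ge 1$, $1<s<\infty$, and let $\rho:(0,\infty)\to(0,\infty)$ be a measurable function such that $\int_0^1\frac{\rho(t)}{t}\,dt<\infty$ and, for some $\varepsilon>0$, the function $r\mapsto \rho(r)/r^{n/s-\varepsilon}$ is almost decreasing on $(0,\infty)$, where $\theta:(0,\infty)\to(0,\infty)$ is called almost decreasing if there is a constant $C_0>0$ with $\theta(t)\le C_0\,\theta(r)$ whenever $0<r<t$. Let $$I_\rho f(x)=\int_{\mathbb R^n}\frac{\rho(|x-y|)}{|x-y|^n}\,f(y)\,dy .$$ An N-function is an increasing convex function $\Psi:[0,\infty)\to[0,\infty)$ (extended by $\Psi(\infty)=\infty$) with $\Psi(0)=0$, $\Psi(t)>0$ for $t>0$, $\lim_{t\to0+}\Psi(t)/t=0$ and $\lim_{t\to\infty}\Psi(t)/t=\infty$. Its inverse is $\Psi^{-1}(u)=\inf\{t\ge0:\Psi(t)>u\}$ for $0\le u<\infty$. The Orlicz space $L^\Psi(\mathbb R^n)$ consists of the measurable $f:\mathbb R^n\to\mathbb C$ with $\int_{\mathbb R^n}\Psi(\epsilon|f(x)|)\,dx<\infty$ for some $\epsilon>0$,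 and carries the norm $\|f\|_{L^\Psi}=\inf\{\lambda>0:\int_{\mathbb R^n}\Psi(|f(x)|/\lambda)\,dx\le1\}$. Then there exist an N-function $\Psi$ and a constant $C>0$ such that, for all $r>0$, $$C^{-1}\,\Psi^{-1}\!\left(\frac1{r^n}\right)\le \frac1{r^{n/s}}\int_0^r\frac{\rho(t)}{t}\,dt\le C\,\Psi^{-1}\!\left(\frac1{r^n}\right),$$ and, moreover, $I_\rho$ is bounded from $L^s(\mathbb R^n)$ to $L^\Psi(\mathbb R^n)$: there is a finite constant $C_1$ such that for every $f\in L^s(\mathbb R^n)$ the integral $I_\rho f(x)$ converges absolutely for almost every $x$, $I_\rho f\in L^\Psi(\mathbb R^n)$, and $\|I_\rho f\|_{L^\Psi}\le C_1\|f\|_{L^s}$. -/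

import Mathlib

open MeasureTheory Set Filter Topology
open scoped ENNReal NNReal

namespace OrliczFrac

noncomputable section

/-- `a(Φ) = sup {t ≥ 0 : Φ t = 0}`, with `sup ∅ = 0`. -/
def zeroBound (Φ : ℝ≥0∞ → ℝ≥0∞) : ℝ≥0∞ := sSup {t | Φ t = 0}

/-- `b(Φ) = inf {t ≥ 0 : Φ t = ∞}`, with `inf ∅ = ∞`. -/
def topBound (Φ : ℝ≥0∞ → ℝ≥0∞) : ℝ≥0∞ := sInf {t | Φ t = ∞}

/-- The class of increasing functions `Φ : [0,∞] → [0,∞]` from which Young functions are taken. -/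
structure IsGrowthFunction (Φ : ℝ≥0∞ → ℝ≥0∞) : Prop where
  mono : Monotone Φ
  zeroBound_lt_top : zeroBound Φ < ∞
  topBound_pos : 0 < topBound Φ
  map_zero : Φ 0 = 0
  tendsto_zero : Tendsto Φ (𝓝[>] 0) (𝓝 0)
  left_continuous : ∀ t < topBound Φ, ContinuousWithinAt Φ (Iio t) t
  of_topBound_eq_top : topBound Φ = ∞ → Φ ∞ = ∞ ∧ Tendsto Φ (𝓝[<] ∞) (𝓝 ∞)
  of_topBound_lt_top : topBound Φ < ∞ →
    Tendsto Φ (𝓝[<] (topBound Φ)) (𝓝 (Φ (topBound Φ)))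

/-- Young functions: growth functions that are convex on `[0, b(Φ))`. -/
structure IsYoungFunction (Φ : ℝ≥0∞ → ℝ≥0∞) : Prop extends IsGrowthFunction Φ where
  convex : ConvexOn ℝ≥0 (Iio (topBound Φ)) Φ

/-- N-functions: Young functions with `a(Φ) = 0` and `b(Φ) = ∞` such that `Φ t / t` tends to `0`
as `t → 0+` and to `∞` as `t → ∞` (`t` finite). -/
structure IsNFunction (Φ : ℝ≥0∞ → ℝ≥0∞) : Prop extends IsYoungFunction Φ where
  zeroBound_eq : zeroBound Φ = 0
  topBound_eq : topBound Φ = ∞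
  tendsto_div_zero : Tendsto (fun t => Φ t / t) (𝓝[>] 0) (𝓝 0)
  tendsto_div_top : Tendsto (fun t => Φ t / t) (𝓝[<] ∞) (𝓝 ∞)

open Classical in
/-- The generalized inverse: `Φ⁻¹(u) = inf {t ≥ 0 : Φ t > u}` for `u < ∞`, and `Φ⁻¹(∞) = ∞`. -/
def genInverse (Φ : ℝ≥0∞ → ℝ≥0∞) (u : ℝ≥0∞) : ℝ≥0∞ :=
  if u = ∞ then ∞ else sInf {t | u < Φ t}

/-- Membership in the Orlicz space `L^Φ(ℝⁿ)` of complex-valued measurable functions. -/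
def MemOrlicz {n : ℕ} (Φ : ℝ≥0∞ → ℝ≥0∞) (f : EuclideanSpace ℝ (Fin n) → ℂ) : Prop :=
  AEStronglyMeasurable f volume ∧
    ∃ ε : ℝ≥0, 0 < ε ∧ ∫⁻ x, Φ ((ε : ℝ≥0∞) * ‖f x‖ₑ) < ∞

/-- The Luxemburg norm `‖f‖_{L^Φ}`, the infimum of the `c ∈ (0,∞)` with `∫ Φ(|f|/c) ≤ 1`
(it is `∞` if there is no such `c`). -/
def orliczNorm {n : ℕ} (Φ : ℝ≥0∞ → ℝ≥0∞) (f : EuclideanSpace ℝ (Fin n) → ℂ) : ℝ≥0∞ :=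
  sInf {c : ℝ≥0∞ | 0 < c ∧ c < ∞ ∧ ∫⁻ x, Φ (‖f x‖ₑ / c) ≤ 1}

/-- A function `θ` on `(0,∞)` is almost decreasing; values outside `(0,∞)` play no role. -/
def AlmostDecreasing (θ : ℝ → ℝ) : Prop :=
  ∃ C : ℝ, 0 < C ∧ ∀ r t : ℝ, 0 < r → r < t → θ t ≤ C * θ r

/-- The integrand `y ↦ ρ(|x-y|) |x-y|⁻ⁿ f(y)` of `I_ρ f (x)`. -/
def fracIntegrand {n : ℕ} (ρ : ℝ → ℝ) (f : EuclideanSpace ℝ (Fin n) → ℂ)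
    (x y : EuclideanSpace ℝ (Fin n)) : ℂ :=
  ((ρ ‖x - y‖ / ‖x - y‖ ^ n : ℝ) : ℂ) * f y

/-- The generalized fractional integral operator `I_ρ`. -/
def fracIntegral {n : ℕ} (ρ : ℝ → ℝ) (f : EuclideanSpace ℝ (Fin n) → ℂ)
    (x : EuclideanSpace ℝ (Fin n)) : ℂ :=
  ∫ y, fracIntegrand ρ f x y

/-- `I_ρ` is bounded from `L^s(ℝⁿ)` to `L^Ψ(ℝⁿ)`: for every `f ∈ L^s` the integral defining
`I_ρ f (x)` converges absolutely for almost every `x`, `I_ρ f ∈ L^Ψ`, and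
`‖I_ρ f‖_{L^Ψ} ≤ C ‖f‖_{L^s}` with `C` finite and independent of `f`. -/
def FracIntegralBounded (n : ℕ) (ρ : ℝ → ℝ) (s : ℝ) (Ψ : ℝ≥0∞ → ℝ≥0∞) : Prop :=
  ∃ C : ℝ≥0, ∀ f : EuclideanSpace ℝ (Fin n) → ℂ, MemLp f (ENNReal.ofReal s) volume →
    (∀ᵐ x, Integrable (fracIntegrand ρ f x) volume) ∧
    MemOrlicz Ψ (fracIntegral ρ f) ∧
    orliczNorm Ψ (fracIntegral ρ f) ≤ (C : ℝ≥0∞) * eLpNorm f (ENNReal.ofReal s) volume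

end

end OrliczFrac

/-!
The proof produces `Ψ` explicitly and then runs Hedberg's argument.

Write `R(r) = ∫₀ʳ ρ(t)/t dt` (`cumulative`) and `G(r) = r ^ (-n/s) R(r)` (`profile`). The almost
decrease of `ρ(r) / r ^ (n/s - ε)` passes to `R` by scaling, so `G(t) ≤ κ (r/t) ^ ε G(r)` for
`r ≤ t`; on the other hand `r ^ n G(r) = r ^ (n - n/s) R(r)` is increasing because `s > 1`. With
`u = r ^ (-n)` this says that `g(u) = G(u ^ (-1/n))` is almost increasing from `0` to `∞`
while `g(u) / u` decreases from `∞` to `0` (`GrowthBound.isInverseProfile`). For such a `g` the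
supremum `Ψ(t) = sup_u u (t / g(u) - 1)₊` of truncated affine functions is an N-function whose
inverse is equivalent to `g` (`IsInverseProfile.isNFunction_young`,
`IsInverseProfile.genInverse_young_le`, `IsInverseProfile.le_mul_genInverse_young`): convexity and
left continuity come for free from the supremum, and the growth conditions are read off from `g`.

For the boundedness, cut `I_ρ |f| (x)` into dyadic annuli around `x`. On an annulus of radius `q`
the values of `ρ` are at most a constant times `∫ ρ(t)/t dt` over `(q/2, q)`. Inside radius `r` the
annuli add up to `R(r)` times the maximal function `M f(x)`; outside, Hölder's inequality gives a
geometric series bounded by `R(r) r ^ (-n/s) ‖f‖_s`. Thus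
`I_ρ |f| (x) ≤ C R(r) (M f(x) + r ^ (-n/s) ‖f‖_s)` for every `r`
(`GrowthBound.exists_potential_le`). Choosing `r` with `r ^ (-n/s) ‖f‖_s = M f(x)` gives
`I_ρ |f| (x) ≤ 2 C ‖f‖_s G(r)`, and hence `Ψ(I_ρ |f| (x) / (C' ‖f‖_s)) ≤ (M f(x) / ‖f‖_s) ^ s`
(`young_potential_le`). The right-hand side has bounded integral by the Hardy–Littlewood maximal
theorem (`exists_lintegral_maximalFunction_rpow_le`), proved here from the Vitali covering lemma
and the layer-cake formula, and convexity of `Ψ` turns the bound into one for the Luxemburg norm.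
-/

namespace OrliczFrac

/-! ### The Hardy–Littlewood maximal function -/

section Maximal

variable {E : Type*} [NormedAddCommGroup E] [NormedSpace ℝ E] [MeasurableSpace E]

/-- The centred Hardy–Littlewood maximal function of `F : E → [0,∞]`. Averages over balls are
normalised by `r ^ dim E` instead of the measure of the ball. -/
noncomputable def maximalFunction (μ : Measure E) (F : E → ℝ≥0∞) (x : E) : ℝ≥0∞ :=
  ⨆ (r : ℝ) (_ : 0 < r),
    (ENNReal.ofReal (r ^ Module.finrank ℝ E))⁻¹ * ∫⁻ y in Metric.ball x r, F y ∂μ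

lemma lt_maximalFunction_iff {μ : Measure E} {F : E → ℝ≥0∞} {x : E} {c : ℝ≥0∞} :
    c < maximalFunction μ F x ↔ ∃ r : ℝ, 0 < r ∧
      c < (ENNReal.ofReal (r ^ Module.finrank ℝ E))⁻¹ * ∫⁻ y in Metric.ball x r, F y ∂μ := by
  simp only [maximalFunction, lt_iSup_iff, exists_prop]

lemma lintegral_ball_le_maximalFunction (μ : Measure E) (F : E → ℝ≥0∞) (x : E) {r : ℝ}
    (hr : 0 < r) :
    ∫⁻ y in Metric.ball x r, F y ∂μ
      ≤ ENNReal.ofReal (r ^ Module.finrank ℝ E) * maximalFunction μ F x := by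
  have h0 : ENNReal.ofReal (r ^ Module.finrank ℝ E) ≠ 0 := by
    rw [Ne, ENNReal.ofReal_eq_zero, not_le]; positivity
  rw [← ENNReal.inv_mul_le_iff h0 ENNReal.ofReal_ne_top]
  exact le_iSup₂ (f := fun (r : ℝ) (_ : 0 < r) =>
    (ENNReal.ofReal (r ^ Module.finrank ℝ E))⁻¹ * ∫⁻ y in Metric.ball x r, F y ∂μ) r hr

lemma maximalFunction_add_le (μ : Measure E) {F G : E → ℝ≥0∞} (hF : Measurable F) (x : E) :
    maximalFunction μ (fun y => F y + G y) x
      ≤ maximalFunction μ F x + maximalFunction μ G x := by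
  refine iSup₂_le fun r hr => ?_
  rw [lintegral_add_left hF, mul_add]
  exact add_le_add
    (le_iSup₂ (f := fun (r : ℝ) (_ : 0 < r) =>
      (ENNReal.ofReal (r ^ Module.finrank ℝ E))⁻¹ * ∫⁻ y in Metric.ball x r, F y ∂μ) r hr)
    (le_iSup₂ (f := fun (r : ℝ) (_ : 0 < r) =>
      (ENNReal.ofReal (r ^ Module.finrank ℝ E))⁻¹ * ∫⁻ y in Metric.ball x r, G y ∂μ) r hr)

lemma isOpen_lt_maximalFunction (μ : Measure E) (F : E → ℝ≥0∞) (c : ℝ≥0∞) :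
    IsOpen {x | c < maximalFunction μ F x} := by
  rw [Metric.isOpen_iff]
  intro x hx
  obtain ⟨r, hr, h⟩ := lt_maximalFunction_iff.1 hx
  set a := (ENNReal.ofReal (r ^ Module.finrank ℝ E))⁻¹
  -- By monotone convergence the strict inequality survives a small decrease of the radius.
  have hU : Metric.ball x r = ⋃ k : ℕ, Metric.ball x (r - 1 / ((k : ℝ) + 1)) := by
    ext y
    simp only [Metric.mem_ball, mem_iUnion]
    constructor
    · intro hy
      obtain ⟨k, hk⟩ := exists_nat_one_div_lt (sub_pos.2 hy)
      exact ⟨k, by linarith⟩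
    · rintro ⟨k, hk⟩
      have : (0 : ℝ) < 1 / ((k : ℝ) + 1) := by positivity
      linarith
  have hmono : Monotone fun k : ℕ => Metric.ball x (r - 1 / ((k : ℝ) + 1)) := by
    intro k l hkl
    apply Metric.ball_subset_ball
    have := Nat.one_div_le_one_div (α := ℝ) hkl
    linarith
  rw [hU, setLIntegral_iUnion_of_directed _ hmono.directed_le, ENNReal.mul_iSup,
    lt_iSup_iff] at h
  obtain ⟨k, hk⟩ := h
  refine ⟨1 / ((k : ℝ) + 1), by positivity, fun z hz => ?_⟩
  refine lt_maximalFunction_iff.2 ⟨r, hr, hk.trans_le ?_⟩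
  refine mul_le_mul_right (lintegral_mono_set ?_) _
  refine Metric.ball_subset_ball' ?_
  rw [Metric.mem_ball, dist_comm] at hz
  linarith

variable [BorelSpace E]

lemma measurable_maximalFunction (μ : Measure E) (F : E → ℝ≥0∞) :
    Measurable (maximalFunction μ F) :=
  measurable_of_Ioi fun c => (isOpen_lt_maximalFunction μ F c).measurableSet

variable [FiniteDimensional ℝ E] [Nontrivial E] (μ : Measure E) [μ.IsAddHaarMeasure]

/-- The weak-type `(1,1)` inequality, by the Vitali covering lemma. -/
lemma maximalFunction_weak_type (F : E → ℝ≥0∞) (c : ℝ≥0∞) :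
    c * μ {x | c < maximalFunction μ F x}
      ≤ 5 ^ Module.finrank ℝ E * μ (Metric.ball 0 1) * ∫⁻ y, F y ∂μ := by
  set d := Module.finrank ℝ E with hd
  have hd0 : d ≠ 0 := Module.finrank_pos.ne'
  rcases eq_or_ne c ∞ with rfl | hct
  · simp
  rcases eq_or_ne c 0 with rfl | hc0
  · simp
  have hball : μ (Metric.ball (0 : E) 1) ≠ 0 := (Metric.measure_ball_pos μ 0 one_pos).ne'
  rcases eq_or_ne (∫⁻ y, F y ∂μ) ∞ with hI | hI
  · rw [hI, ENNReal.mul_top (mul_ne_zero (pow_ne_zero _ (by norm_num)) hball)]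
    exact le_top
  set S := {x | c < maximalFunction μ F x} with hS
  have key : ∀ x ∈ S, ∃ r : ℝ, 0 < r ∧
      c * ENNReal.ofReal (r ^ d) ≤ ∫⁻ y in Metric.ball x r, F y ∂μ := by
    intro x hx
    obtain ⟨r, hr, h⟩ := lt_maximalFunction_iff.1 hx
    refine ⟨r, hr, ?_⟩
    have h0 : ENNReal.ofReal (r ^ d) ≠ 0 := by
      rw [Ne, ENNReal.ofReal_eq_zero, not_le]; positivity
    rw [mul_comm]
    refine (mul_le_mul_right h.le _).trans_eq ?_
    rw [← mul_assoc, ENNReal.mul_inv_cancel h0 ENNReal.ofReal_ne_top, one_mul]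
  choose! r hr0 hr using key
  have hbdd : ∀ x ∈ S, r x ≤ max 1 ((∫⁻ y, F y ∂μ) / c).toReal := by
    intro x hx
    rcases le_total (r x) 1 with h1 | h1
    · exact h1.trans (le_max_left _ _)
    · refine le_trans ?_ (le_max_right _ _)
      rw [← ENNReal.ofReal_le_iff_le_toReal (ENNReal.div_ne_top hI hc0),
        ENNReal.le_div_iff_mul_le (Or.inl hc0) (Or.inl hct), mul_comm]
      calc c * ENNReal.ofReal (r x) ≤ c * ENNReal.ofReal (r x ^ d) := by
            gcongr; exact le_self_pow₀ h1 hd0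
        _ ≤ _ := (hr x hx).trans (setLIntegral_le_lintegral _ _)
  obtain ⟨u, huS, hdisj, hcov⟩ := Vitali.exists_disjoint_subfamily_covering_enlargement_closedBall
    S id r _ hbdd 5 (by norm_num)
  have hucount : u.Countable := hdisj.countable_of_nonempty_interior fun x hx =>
    ⟨x, Metric.ball_subset_interior_closedBall (Metric.mem_ball_self (hr0 x (huS hx)))⟩
  have hsub : S ⊆ ⋃ x ∈ u, Metric.closedBall x (5 * r x) := by
    intro x hx
    obtain ⟨b, hb, hxb⟩ := hcov x hx
    exact mem_biUnion hb (hxb (Metric.mem_closedBall_self (hr0 x hx).le))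
  have := hucount.to_subtype
  calc c * μ S ≤ c * ∑' x : u, μ (Metric.closedBall (x : E) (5 * r x)) := by
        gcongr
        exact (measure_mono hsub).trans (measure_biUnion_le μ hucount _)
    _ = ∑' x : u, 5 ^ d * μ (Metric.ball 0 1) * (c * ENNReal.ofReal (r x ^ d)) := by
        rw [← ENNReal.tsum_mul_left]
        refine tsum_congr fun x => ?_
        have := hr0 x (huS x.2)
        rw [Measure.addHaar_closedBall μ _ (by positivity), ← hd, mul_pow,
          ENNReal.ofReal_mul (by positivity), ENNReal.ofReal_pow (by norm_num) d]
        norm_num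
        ring
    _ ≤ ∑' x : u, 5 ^ d * μ (Metric.ball 0 1) *
          ∫⁻ y in Metric.closedBall (x : E) (r x), F y ∂μ := by
        gcongr with x
        exact (hr x (huS x.2)).trans (lintegral_mono_set Metric.ball_subset_closedBall)
    _ = 5 ^ d * μ (Metric.ball 0 1) * ∫⁻ y in ⋃ x ∈ u, Metric.closedBall x (r x), F y ∂μ := by
        rw [ENNReal.tsum_mul_left]
        congr 1
        exact (lintegral_biUnion hucount
          (fun x _ => Metric.isClosed_closedBall.measurableSet) hdisj F).symm
    _ ≤ _ := mul_le_mul_right (setLIntegral_le_lintegral _ _) _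

/-- The weak-type inequality with only the part of `F` above height `c` on the right: the rest of
`F` contributes at most `c |B(0,1)|` to the maximal function. -/
lemma maximalFunction_weak_type_truncated {F : E → ℝ≥0∞} (hF : Measurable F) (c : ℝ≥0∞) :
    c * μ {x | 2 * (c * μ (Metric.ball 0 1)) < maximalFunction μ F x}
      ≤ 5 ^ Module.finrank ℝ E * ∫⁻ y in {y | c < F y}, F y ∂μ := by
  have hb0 : μ (Metric.ball (0 : E) 1) ≠ 0 := (Metric.measure_ball_pos μ 0 one_pos).ne'
  have hbt : μ (Metric.ball (0 : E) 1) ≠ ∞ := measure_ball_lt_top.ne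
  have hmeas : MeasurableSet {y | c < F y} := measurableSet_lt measurable_const hF
  have hle : ∀ x, maximalFunction μ F x ≤
      maximalFunction μ ({y | c < F y}.indicator F) x + c * μ (Metric.ball 0 1) := by
    intro x
    have hsplit : F = fun y => {y | c < F y}.indicator F y + {y | c < F y}ᶜ.indicator F y := by
      funext y; exact (Set.indicator_self_add_compl_apply _ F y).symm
    refine ((congrArg (fun G => maximalFunction μ G x) hsplit).le.trans
      (maximalFunction_add_le μ (hF.indicator hmeas) x)).trans ?_
    gcongr
    refine iSup₂_le fun r hr => ?_
    have h0 : ENNReal.ofReal (r ^ Module.finrank ℝ E) ≠ 0 := by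
      rw [Ne, ENNReal.ofReal_eq_zero, not_le]; positivity
    rw [ENNReal.inv_mul_le_iff h0 ENNReal.ofReal_ne_top]
    calc ∫⁻ y in Metric.ball x r, {y | c < F y}ᶜ.indicator F y ∂μ
        ≤ ∫⁻ y in Metric.ball x r, c ∂μ := by
          refine lintegral_mono fun y => ?_
          by_cases h : c < F y
          · rw [Set.indicator_of_notMem (by simpa using h)]; exact zero_le
          · rw [Set.indicator_of_mem (by simpa using h)]; exact not_lt.1 h
      _ = _ := by
          rw [lintegral_const, Measure.restrict_apply_univ, Measure.addHaar_ball μ _ hr.le]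
          ring
  have hweak := maximalFunction_weak_type μ ({y | c < F y}.indicator F)
    (c * μ (Metric.ball (0 : E) 1))
  rw [lintegral_indicator hmeas] at hweak
  rw [← ENNReal.mul_le_mul_iff_right hb0 hbt]
  calc μ (Metric.ball (0 : E) 1) *
        (c * μ {x | 2 * (c * μ (Metric.ball 0 1)) < maximalFunction μ F x})
      ≤ μ (Metric.ball (0 : E) 1) * (c * μ {x | c * μ (Metric.ball (0 : E) 1) <
          maximalFunction μ ({y | c < F y}.indicator F) x}) := by
        refine mul_le_mul_right (mul_le_mul_right (measure_mono fun x hx => ?_) _) _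
        by_contra h
        have h' := (hle x).trans (add_le_add_left (not_lt.1 h) _)
        rw [← two_mul] at h'
        exact absurd hx (not_lt.2 h')
    _ = c * μ (Metric.ball (0 : E) 1) * μ {x | c * μ (Metric.ball (0 : E) 1) <
          maximalFunction μ ({y | c < F y}.indicator F) x} := by ring
    _ ≤ _ := hweak
    _ = _ := by ring

/-- The maximal function of an `L^p` function is finite almost everywhere. -/
lemma ae_maximalFunction_lt_top {F : E → ℝ≥0} (hF : Measurable F) {p : ℝ} (hp : 1 < p)
    (hFp : ∫⁻ y, (F y : ℝ≥0∞) ^ p ∂μ ≠ ∞) :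
    ∀ᵐ x ∂μ, maximalFunction μ (fun y => (F y : ℝ≥0∞)) x < ∞ := by
  set K : ℝ≥0∞ := 5 ^ Module.finrank ℝ E * ∫⁻ y, (F y : ℝ≥0∞) ^ p ∂μ with hK
  have hKt : K ≠ ∞ := ENNReal.mul_ne_top (by finiteness) hFp
  set S := {x | ¬ maximalFunction μ (fun y => (F y : ℝ≥0∞)) x < ∞} with hS
  have hbt : μ (Metric.ball (0 : E) 1) ≠ ∞ := measure_ball_lt_top.ne
  have key : ∀ k : ℕ, 1 ≤ k → (k : ℝ≥0∞) * μ S ≤ K := by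
    intro k hk
    have hk' : (1 : ℝ≥0∞) ≤ k := by exact_mod_cast hk
    have h := maximalFunction_weak_type_truncated μ hF.coe_nnreal_ennreal (k : ℝ≥0∞)
    refine le_trans (mul_le_mul_right (measure_mono fun x hx => ?_) _) (h.trans ?_)
    · have hx' : maximalFunction μ (fun y => (F y : ℝ≥0∞)) x = ∞ := by
        simpa [hS] using hx
      simp only [mem_ofPred_eq, hx']
      exact (ENNReal.mul_ne_top (by finiteness)
        (ENNReal.mul_ne_top (by finiteness) hbt)).lt_top
    · refine mul_le_mul_right (le_trans ?_ (setLIntegral_le_lintegral {y | (k : ℝ≥0∞) < F y} _)) _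
      refine setLIntegral_mono (by fun_prop) fun y hy => ?_
      exact ENNReal.le_rpow_self_of_one_le (hk'.trans hy.le) hp.le
  rw [ae_iff]
  by_contra h0
  obtain ⟨k, hk⟩ := ENNReal.exists_nat_mul_gt h0 hKt
  have hk1 : 1 ≤ k := by
    by_contra hlt
    obtain rfl : k = 0 := by omega
    simp at hk
  exact absurd hk (not_lt.2 (key k hk1))

/-- The Hardy–Littlewood maximal theorem on `L^p`, `1 < p < ∞`. -/
theorem exists_lintegral_maximalFunction_rpow_le {p : ℝ} (hp : 1 < p) :
    ∃ A : ℝ≥0, ∀ F : E → ℝ≥0, Measurable F → ∫⁻ y, (F y : ℝ≥0∞) ^ p ∂μ ≠ ∞ →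
      ∫⁻ x, maximalFunction μ (fun y => (F y : ℝ≥0∞)) x ^ p ∂μ
        ≤ A * ∫⁻ y, (F y : ℝ≥0∞) ^ p ∂μ := by
  set b := μ (Metric.ball (0 : E) 1) with hb
  have hb0 : b ≠ 0 := (Metric.measure_ball_pos μ 0 one_pos).ne'
  have hbt : b ≠ ∞ := measure_ball_lt_top.ne
  have h2b0 : 2 * b ≠ 0 := mul_ne_zero (by norm_num) hb0
  have h2bt : 2 * b ≠ ∞ := ENNReal.mul_ne_top (by norm_num) hbt
  set D : ℝ≥0∞ := 5 ^ Module.finrank ℝ E with hD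
  have hp0 : 0 < p := by linarith
  have hp1 : 0 < p - 1 := by linarith
  have hq0 : ENNReal.ofReal (p - 1) ≠ 0 := by simpa using hp1
  set A : ℝ≥0∞ := (2 * b) ^ p * (ENNReal.ofReal p * (D * (ENNReal.ofReal (p - 1))⁻¹)) with hA
  have hAt : A ≠ ∞ := by
    refine ENNReal.mul_ne_top (ENNReal.rpow_ne_top_of_nonneg hp0.le h2bt) ?_
    refine ENNReal.mul_ne_top ENNReal.ofReal_ne_top (ENNReal.mul_ne_top (by finiteness) ?_)
    exact ENNReal.inv_ne_top.2 hq0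
  refine ⟨A.toNNReal, fun F hF hFp => ?_⟩
  rw [ENNReal.coe_toNNReal hAt]
  set M := maximalFunction μ (fun y => (F y : ℝ≥0∞)) with hM
  set G : E → ℝ := fun x => (M x / (2 * b)).toReal with hG
  have hMmeas : Measurable M := measurable_maximalFunction μ _
  have hGmeas : Measurable G := (hMmeas.div_const _).ennreal_toReal
  have hfin := ae_maximalFunction_lt_top μ hF hp hFp
  set ν := μ.withDensity (fun y => (F y : ℝ≥0∞)) with hν
  have hMG : ∫⁻ x, M x ^ p ∂μ = (2 * b) ^ p * ∫⁻ x, ENNReal.ofReal (G x ^ p) ∂μ := by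
    rw [← lintegral_const_mul _ (by fun_prop)]
    refine lintegral_congr_ae ?_
    filter_upwards [hfin] with x hx
    rw [← ENNReal.ofReal_rpow_of_nonneg ENNReal.toReal_nonneg hp0.le,
      ENNReal.ofReal_toReal (ENNReal.div_ne_top hx.ne h2b0),
      ← ENNReal.mul_rpow_of_nonneg _ _ hp0.le, ENNReal.mul_div_cancel h2b0 h2bt]
  -- The weak-type inequality at height `t`, read as a bound by the measure `ν = F μ`.
  have hweak : ∀ t : ℝ, 0 < t → μ {x | t < G x} * ENNReal.ofReal (t ^ (p - 1))
      ≤ D * (ν {y | t < (F y : ℝ)} * ENNReal.ofReal (t ^ (p - 1 - 1))) := by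
    intro t ht
    have hset : {y | t < (F y : ℝ)} = {y | ENNReal.ofReal t < (F y : ℝ≥0∞)} := by
      ext y
      simp only [mem_ofPred_eq]
      rw [← ENNReal.ofReal_coe_nnreal, ENNReal.ofReal_lt_ofReal_iff_of_nonneg ht.le]
    have h := maximalFunction_weak_type_truncated μ hF.coe_nnreal_ennreal (ENNReal.ofReal t)
    have hνset : ν {y | t < (F y : ℝ)} = ∫⁻ y in {y | ENNReal.ofReal t < (F y : ℝ≥0∞)}, F y ∂μ := by
      rw [hset, hν, withDensity_apply _
        (measurableSet_lt measurable_const hF.coe_nnreal_ennreal)]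
    rw [← hνset] at h
    have hsub : {x | t < G x} ⊆ {x | 2 * (ENNReal.ofReal t * b) < M x} := by
      intro x hx
      have h1 : ENNReal.ofReal t < M x / (2 * b) := by
        by_contra hcon
        have := ENNReal.toReal_mono ENNReal.ofReal_ne_top (not_lt.1 hcon)
        rw [ENNReal.toReal_ofReal ht.le] at this
        exact absurd hx (not_lt.2 this)
      rw [ENNReal.lt_div_iff_mul_lt (Or.inl h2b0) (Or.inl h2bt)] at h1
      simp only [mem_ofPred_eq]
      calc _ = ENNReal.ofReal t * (2 * b) := by ring
        _ < _ := h1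
    have ht1 : ENNReal.ofReal (t ^ (p - 1)) =
        ENNReal.ofReal t * ENNReal.ofReal (t ^ (p - 1 - 1)) := by
      rw [← ENNReal.ofReal_mul ht.le]
      congr 1
      conv_rhs => rw [← Real.rpow_one_add' ht.le (by linarith)]
      congr 1; ring
    calc μ {x | t < G x} * ENNReal.ofReal (t ^ (p - 1))
        ≤ (ENNReal.ofReal t * μ {x | 2 * (ENNReal.ofReal t * b) < M x})
            * ENNReal.ofReal (t ^ (p - 1 - 1)) := by
          rw [ht1, ← mul_assoc, mul_comm (μ _)]
          gcongr
      _ ≤ (D * ν {y | t < (F y : ℝ)}) * ENNReal.ofReal (t ^ (p - 1 - 1)) := by gcongr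
      _ = _ := by ring
  -- The layer-cake formula for `ν` with exponent `p - 1` evaluates the resulting integral.
  have hlayer : ∫⁻ t in Ioi (0 : ℝ), ν {y | t < (F y : ℝ)} * ENNReal.ofReal (t ^ (p - 1 - 1))
      = (ENNReal.ofReal (p - 1))⁻¹ * ∫⁻ y, (F y : ℝ≥0∞) ^ p ∂μ := by
    have h := lintegral_rpow_eq_lintegral_meas_lt_mul ν (f := fun y => (F y : ℝ))
      (ae_of_all _ fun y => (F y).2) (by fun_prop) hp1
    have hint : ∫⁻ y, ENNReal.ofReal ((F y : ℝ) ^ (p - 1)) ∂ν = ∫⁻ y, (F y : ℝ≥0∞) ^ p ∂μ := by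
      rw [hν, lintegral_withDensity_eq_lintegral_mul _ hF.coe_nnreal_ennreal (by fun_prop)]
      refine lintegral_congr fun y => ?_
      rw [Pi.mul_apply, ← ENNReal.ofReal_rpow_of_nonneg (F y).coe_nonneg hp1.le,
        ENNReal.ofReal_coe_nnreal]
      conv_rhs => rw [show p = 1 + (p - 1) by ring,
        ENNReal.rpow_add_of_nonneg _ _ zero_le_one hp1.le, ENNReal.rpow_one]
    rw [hint] at h
    rw [h, ← mul_assoc, ENNReal.inv_mul_cancel hq0 ENNReal.ofReal_ne_top, one_mul]
  rw [hMG, lintegral_rpow_eq_lintegral_meas_lt_mul μ (ae_of_all _ fun x => ENNReal.toReal_nonneg)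
    hGmeas.aemeasurable hp0]
  calc (2 * b) ^ p * (ENNReal.ofReal p * ∫⁻ t in Ioi (0 : ℝ),
        μ {x | t < G x} * ENNReal.ofReal (t ^ (p - 1)))
      ≤ (2 * b) ^ p * (ENNReal.ofReal p * ∫⁻ t in Ioi (0 : ℝ),
        D * (ν {y | t < (F y : ℝ)} * ENNReal.ofReal (t ^ (p - 1 - 1)))) := by
        refine mul_le_mul_right (mul_le_mul_right ?_ _) _
        exact setLIntegral_mono' measurableSet_Ioi fun t ht => hweak t ht
    _ = A * ∫⁻ y, (F y : ℝ≥0∞) ^ p ∂μ := by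
        rw [lintegral_const_mul' _ _ (by finiteness), hlayer, hA]
        ring

end Maximal

/-! ### N-functions with a prescribed inverse up to equivalence -/

/-- The conditions on `G` under which `u ↦ G (u ^ (-1 / n))` is equivalent to the inverse of an
N-function: `G` is almost decreasing (with constant `c`) from `∞` to `0`, while `r ^ n * G r`
increases from `0` to `∞`. Only the values of `G` on `(0, ∞)` matter. -/
structure IsInverseProfile (n : ℕ) (G : ℝ → ℝ≥0∞) (c : ℝ≥0) : Prop where
  one_le : 1 ≤ c
  ne_zero : ∀ r, 0 < r → G r ≠ 0
  ne_top : ∀ r, 0 < r → G r ≠ ∞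
  le_mul : ∀ r t, 0 < r → r ≤ t → G t ≤ c * G r
  mono : ∀ r t, 0 < r → r ≤ t →
    ENNReal.ofReal (r ^ n) * G r ≤ ENNReal.ofReal (t ^ n) * G t
  tendsto_zero : Tendsto G (𝓝[>] 0) (𝓝 ∞)
  tendsto_atTop : Tendsto G atTop (𝓝 0)
  mul_tendsto_zero : Tendsto (fun r => ENNReal.ofReal (r ^ n) * G r) (𝓝[>] 0) (𝓝 0)
  mul_tendsto_atTop : Tendsto (fun r => ENNReal.ofReal (r ^ n) * G r) atTop (𝓝 ∞)

/-- The supremum of the truncated affine functions `t ↦ u (t / g u - 1)₊` over `u > 0`, where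
`g u = G r` with `u = r ^ (-n)`. The family is indexed by `r`. -/
noncomputable def youngOfInverse (n : ℕ) (G : ℝ → ℝ≥0∞) (t : ℝ≥0∞) : ℝ≥0∞ :=
  ⨆ (r : ℝ) (_ : 0 < r), (ENNReal.ofReal (r ^ n))⁻¹ * (t / G r - 1)

lemma monotone_youngOfInverse (n : ℕ) (G : ℝ → ℝ≥0∞) : Monotone (youngOfInverse n G) := by
  intro s t hst
  refine iSup₂_mono fun r _ => ?_
  gcongr

lemma youngOfInverse_mul_le (n : ℕ) (G : ℝ → ℝ≥0∞) {a : ℝ≥0∞} (ha : a ≤ 1) (t : ℝ≥0∞) :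
    youngOfInverse n G (a * t) ≤ a * youngOfInverse n G t := by
  refine iSup₂_le fun r hr => ?_
  have h1 : a * t / G r - 1 ≤ a * (t / G r - 1) := by
    rw [tsub_le_iff_right, mul_div_assoc]
    calc a * (t / G r) ≤ a * (t / G r - 1 + 1) := by gcongr; exact le_tsub_add
      _ = a * (t / G r - 1) + a := by ring
      _ ≤ _ := by gcongr
  calc _ ≤ (ENNReal.ofReal (r ^ n))⁻¹ * (a * (t / G r - 1)) := by gcongr
    _ = a * ((ENNReal.ofReal (r ^ n))⁻¹ * (t / G r - 1)) := by ring
    _ ≤ _ := mul_le_mul_right (le_iSup₂ (f := fun (r : ℝ) (_ : 0 < r) =>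
      (ENNReal.ofReal (r ^ n))⁻¹ * (t / G r - 1)) r hr) _

lemma youngOfInverse_convex (n : ℕ) (G : ℝ → ℝ≥0∞) {a b : ℝ≥0∞} (hab : a + b = 1)
    (x y : ℝ≥0∞) :
    youngOfInverse n G (a * x + b * y) ≤ a * youngOfInverse n G x + b * youngOfInverse n G y := by
  refine iSup₂_le fun r hr => ?_
  have h1 : (a * x + b * y) / G r - 1 ≤ a * (x / G r - 1) + b * (y / G r - 1) := by
    rw [tsub_le_iff_right, ENNReal.add_div, mul_div_assoc, mul_div_assoc]
    calc a * (x / G r) + b * (y / G r)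
        ≤ a * (x / G r - 1 + 1) + b * (y / G r - 1 + 1) := by
          gcongr <;> exact le_tsub_add
      _ = a * (x / G r - 1) + b * (y / G r - 1) + (a + b) := by ring
      _ = _ := by rw [hab]
  have hle : ∀ t, (ENNReal.ofReal (r ^ n))⁻¹ * (t / G r - 1) ≤ youngOfInverse n G t := fun t =>
    le_iSup₂ (f := fun (r : ℝ) (_ : 0 < r) => (ENNReal.ofReal (r ^ n))⁻¹ * (t / G r - 1)) r hr
  calc _ ≤ (ENNReal.ofReal (r ^ n))⁻¹ * (a * (x / G r - 1) + b * (y / G r - 1)) := by gcongr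
    _ = a * ((ENNReal.ofReal (r ^ n))⁻¹ * (x / G r - 1))
        + b * ((ENNReal.ofReal (r ^ n))⁻¹ * (y / G r - 1)) := by ring
    _ ≤ _ := by gcongr <;> exact hle _

lemma ofReal_pow_ne_zero {r : ℝ} (hr : 0 < r) (n : ℕ) : ENNReal.ofReal (r ^ n) ≠ 0 := by
  rw [Ne, ENNReal.ofReal_eq_zero, not_le]; positivity

namespace IsInverseProfile

variable {n : ℕ} {G : ℝ → ℝ≥0∞} {c : ℝ≥0}

lemma mul_ne_zero (h : IsInverseProfile n G c) {r : ℝ} (hr : 0 < r) :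
    ENNReal.ofReal (r ^ n) * G r ≠ 0 :=
  _root_.mul_ne_zero (ofReal_pow_ne_zero hr n) (h.ne_zero r hr)

lemma mul_ne_top (h : IsInverseProfile n G c) {r : ℝ} (hr : 0 < r) :
    ENNReal.ofReal (r ^ n) * G r ≠ ∞ :=
  ENNReal.mul_ne_top ENNReal.ofReal_ne_top (h.ne_top r hr)

/-- For small `t` only the indices beyond `r` contribute to the supremum, and there the slopes
are at most `1 / (r ^ n * G r)`. -/
lemma young_le_div (h : IsInverseProfile n G c) {r : ℝ} (hr : 0 < r) {t : ℝ≥0∞}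
    (ht : c * t < G r) :
    youngOfInverse n G t ≤ t / (ENNReal.ofReal (r ^ n) * G r) := by
  refine iSup₂_le fun q hq => ?_
  rcases le_or_gt t (G q) with htq | htq
  · rw [tsub_eq_zero_of_le (ENNReal.div_le_of_le_mul (by rwa [one_mul])), mul_zero]
    exact zero_le
  have hrq : r ≤ q := by
    by_contra hcon
    refine absurd ht (not_lt.2 ((h.le_mul q r hq (not_le.1 hcon).le).trans ?_))
    gcongr
  calc (ENNReal.ofReal (q ^ n))⁻¹ * (t / G q - 1)
      ≤ (ENNReal.ofReal (q ^ n))⁻¹ * (t / G q) := by gcongr; exact tsub_le_self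
    _ = t / (ENNReal.ofReal (q ^ n) * G q) := by
        rw [div_eq_mul_inv, div_eq_mul_inv, ENNReal.mul_inv (Or.inl (ofReal_pow_ne_zero hq n))
          (Or.inl ENNReal.ofReal_ne_top)]
        ring
    _ ≤ _ := ENNReal.div_le_div_left (h.mono r q hr hrq) _

lemma div_le_young (h : IsInverseProfile n G c) {r : ℝ} (hr : 0 < r) {t : ℝ≥0∞}
    (ht : 2 * G r ≤ t) :
    t / (2 * (ENNReal.ofReal (r ^ n) * G r)) ≤ youngOfInverse n G t := by
  refine le_trans ?_ (le_iSup₂ (f := fun (r : ℝ) (_ : 0 < r) =>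
    (ENNReal.ofReal (r ^ n))⁻¹ * (t / G r - 1)) r hr)
  have h2 : 2 * G r ≠ 0 := _root_.mul_ne_zero two_ne_zero (h.ne_zero r hr)
  have h2t : 2 * G r ≠ ∞ := ENNReal.mul_ne_top (by norm_num) (h.ne_top r hr)
  have hsum : t / (2 * G r) + t / (2 * G r) = t / G r := by
    rw [← two_mul, mul_comm, ← ENNReal.mul_div_right_comm,
      mul_comm 2 (G r), ENNReal.mul_div_mul_right _ _ (by norm_num) (by norm_num)]
  have h1 : 1 ≤ t / (2 * G r) := by
    rwa [ENNReal.le_div_iff_mul_le (Or.inl h2) (Or.inl h2t), one_mul]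
  have h3 : t / (2 * G r) ≤ t / G r - 1 := by
    refine ENNReal.le_sub_of_add_le_right (by norm_num) ?_
    rw [← hsum]; gcongr
  calc t / (2 * (ENNReal.ofReal (r ^ n) * G r))
      = (ENNReal.ofReal (r ^ n))⁻¹ * (t / (2 * G r)) := by
        rw [mul_left_comm, div_eq_mul_inv, div_eq_mul_inv,
          ENNReal.mul_inv (Or.inl (ofReal_pow_ne_zero hr n)) (Or.inl ENNReal.ofReal_ne_top)]
        ring
    _ ≤ _ := by gcongr

lemma young_le (h : IsInverseProfile n G c) {r : ℝ} (hr : 0 < r) {t : ℝ≥0∞}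
    (ht : c * t < G r) : youngOfInverse n G t ≤ (ENNReal.ofReal (r ^ n))⁻¹ := by
  have hc : (1 : ℝ≥0∞) ≤ c := by exact_mod_cast h.one_le
  refine (h.young_le_div hr ht).trans (ENNReal.div_le_of_le_mul ?_)
  rw [← mul_assoc, ENNReal.inv_mul_cancel (ofReal_pow_ne_zero hr n) ENNReal.ofReal_ne_top, one_mul]
  exact (le_mul_of_one_le_left zero_le hc).trans ht.le

lemma lt_young (h : IsInverseProfile n G c) {r : ℝ} (hr : 0 < r) {t : ℝ≥0∞}
    (ht : 2 * G r < t) : (ENNReal.ofReal (r ^ n))⁻¹ < youngOfInverse n G t := by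
  refine lt_of_lt_of_le ?_ (h.div_le_young hr ht.le)
  have hH0 : 2 * (ENNReal.ofReal (r ^ n) * G r) ≠ 0 :=
    _root_.mul_ne_zero two_ne_zero (h.mul_ne_zero hr)
  have hHt : 2 * (ENNReal.ofReal (r ^ n) * G r) ≠ ∞ :=
    ENNReal.mul_ne_top (by norm_num) (h.mul_ne_top hr)
  rw [ENNReal.lt_div_iff_mul_lt (Or.inl hH0) (Or.inl hHt), mul_left_comm, ← mul_assoc _ _ (G r),
    ENNReal.inv_mul_cancel (ofReal_pow_ne_zero hr n) ENNReal.ofReal_ne_top, one_mul]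
  exact ht

lemma eq_top_of_young_eq_top (h : IsInverseProfile n G c) {t : ℝ≥0∞}
    (ht : youngOfInverse n G t = ∞) : t = ∞ := by
  by_contra hne
  have hct : (c : ℝ≥0∞) * t < ∞ := ENNReal.mul_lt_top (by finiteness) (lt_top_iff_ne_top.2 hne)
  obtain ⟨r, hr, hr0⟩ := ((h.tendsto_zero.eventually_const_lt hct).and self_mem_nhdsWithin).exists
  have := h.young_le hr0 hr
  rw [ht, top_le_iff, ENNReal.inv_eq_top] at this
  exact ofReal_pow_ne_zero hr0 n this

lemma young_pos (h : IsInverseProfile n G c) {t : ℝ≥0∞} (ht : t ≠ 0) :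
    0 < youngOfInverse n G t := by
  have ht2 : 0 < t / 2 := ENNReal.half_pos ht
  obtain ⟨r, hr, hr0⟩ :=
    ((h.tendsto_atTop.eventually_lt_const ht2).and (eventually_gt_atTop 0)).exists
  refine (zero_le).trans_lt (h.lt_young hr0 ?_)
  rwa [mul_comm, ← ENNReal.lt_div_iff_mul_lt (Or.inl two_ne_zero) (Or.inl (by norm_num))]

lemma topBound_young (h : IsInverseProfile n G c) : topBound (youngOfInverse n G) = ∞ :=
  sInf_eq_top.2 fun _ ht => h.eq_top_of_young_eq_top ht

lemma zeroBound_young (h : IsInverseProfile n G c) : zeroBound (youngOfInverse n G) = 0 := by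
  refine le_antisymm (sSup_le fun t ht => ?_) zero_le
  by_contra hcon
  exact (h.young_pos (not_le.1 hcon).ne').ne' ht

lemma lowerSemicontinuous_young (h : IsInverseProfile n G c) :
    LowerSemicontinuous (youngOfInverse n G) := by
  refine lowerSemicontinuous_iSup fun r => lowerSemicontinuous_iSup fun hr => ?_
  refine Continuous.lowerSemicontinuous ?_
  refine (ENNReal.continuous_const_mul (ENNReal.inv_ne_top.2 (ofReal_pow_ne_zero hr n))).comp ?_
  exact (ENNReal.continuous_sub_right 1).comp (ENNReal.continuous_div_const _ (h.ne_zero r hr))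

lemma leftContinuous_young (h : IsInverseProfile n G c) (t : ℝ≥0∞) :
    Tendsto (youngOfInverse n G) (𝓝[<] t) (𝓝 (youngOfInverse n G t)) := by
  refine tendsto_order.2 ⟨fun a ha => ?_, fun a ha => ?_⟩
  · exact mem_nhdsWithin_of_mem_nhds (h.lowerSemicontinuous_young t a ha)
  · filter_upwards [self_mem_nhdsWithin] with x hx
    exact (monotone_youngOfInverse n G (le_of_lt hx)).trans_lt ha

lemma young_div_tendsto_zero (h : IsInverseProfile n G c) :
    Tendsto (fun t => youngOfInverse n G t / t) (𝓝[>] 0) (𝓝 0) := by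
  rw [ENNReal.tendsto_nhds_zero]
  intro η hη
  obtain ⟨r, hr, hr0⟩ := ((h.mul_tendsto_atTop.eventually_const_lt
    (ENNReal.inv_lt_top.2 hη)).and (eventually_gt_atTop 0)).exists
  have hG : 0 < G r / c := ENNReal.div_pos (h.ne_zero r hr0) ENNReal.coe_ne_top
  have hc0 : (c : ℝ≥0∞) ≠ 0 := by
    have := h.one_le
    exact_mod_cast (zero_lt_one.trans_le this).ne'
  filter_upwards [self_mem_nhdsWithin, mem_nhdsWithin_of_mem_nhds (Iio_mem_nhds hG)] with t ht0 ht
  have hct : c * t < G r := by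
    rwa [mul_comm, ← ENNReal.lt_div_iff_mul_lt (Or.inl hc0) (Or.inl ENNReal.coe_ne_top)]
  refine ENNReal.div_le_of_le_mul ((h.young_le_div hr0 hct).trans ?_)
  rw [div_eq_mul_inv, mul_comm]
  gcongr
  exact ENNReal.inv_le_iff_inv_le.1 hr.le

lemma young_tendsto_zero (h : IsInverseProfile n G c) :
    Tendsto (youngOfInverse n G) (𝓝[>] 0) (𝓝 0) := by
  have hb : ∀ᶠ t in 𝓝[>] (0 : ℝ≥0∞), youngOfInverse n G t ≤ t := by
    have := (ENNReal.tendsto_nhds_zero.1 h.young_div_tendsto_zero) 1 one_pos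
    filter_upwards [this, self_mem_nhdsWithin,
      mem_nhdsWithin_of_mem_nhds (Iio_mem_nhds ENNReal.zero_lt_top)] with t ht h0 htt
    rwa [ENNReal.div_le_iff (ne_of_gt h0) (ne_of_lt htt), one_mul] at ht
  exact tendsto_of_tendsto_of_tendsto_of_le_of_le' tendsto_const_nhds
    (tendsto_id.mono_left nhdsWithin_le_nhds) (Eventually.of_forall fun _ => zero_le) hb

lemma young_div_tendsto_top (h : IsInverseProfile n G c) :
    Tendsto (fun t => youngOfInverse n G t / t) (𝓝[<] ∞) (𝓝 ∞) := by
  rw [ENNReal.tendsto_nhds_top_iff_nnreal]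
  intro K
  have hK : (0 : ℝ≥0∞) < (2 * (K + 1 : ℝ≥0∞))⁻¹ := ENNReal.inv_pos.2 (by finiteness)
  obtain ⟨r, hr, hr0⟩ := ((h.mul_tendsto_zero.eventually_lt_const hK).and
    self_mem_nhdsWithin).exists
  have h2t : 2 * G r < ∞ := ENNReal.mul_lt_top (by norm_num) (h.ne_top r hr0).lt_top
  filter_upwards [self_mem_nhdsWithin, mem_nhdsWithin_of_mem_nhds (Ioi_mem_nhds h2t)] with t htt ht
  have ht0 : t ≠ 0 := (zero_le.trans_lt ht).ne'
  have h1 := h.div_le_young hr0 (le_of_lt ht)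
  have h2 : (2 * (ENNReal.ofReal (r ^ n) * G r))⁻¹ ≤ youngOfInverse n G t / t := by
    rw [ENNReal.le_div_iff_mul_le (Or.inl ht0) (Or.inl (ne_of_lt htt)), mul_comm,
      ← div_eq_mul_inv]
    exact h1
  refine lt_of_lt_of_le ?_ h2
  rw [ENNReal.lt_inv_iff_lt_inv, mul_comm,
    ← ENNReal.lt_div_iff_mul_lt (Or.inl two_ne_zero) (Or.inl (by norm_num))]
  refine hr.trans_le ?_
  rw [ENNReal.mul_inv (Or.inl two_ne_zero) (Or.inl (by norm_num)), mul_comm, div_eq_mul_inv]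
  gcongr
  exact le_self_add

/-- The N-function attached to an inverse profile. -/
theorem isNFunction_young (h : IsInverseProfile n G c) : IsNFunction (youngOfInverse n G) where
  mono := monotone_youngOfInverse n G
  zeroBound_lt_top := by rw [h.zeroBound_young]; exact ENNReal.zero_lt_top
  topBound_pos := by rw [h.topBound_young]; exact ENNReal.zero_lt_top
  map_zero := by simp [youngOfInverse]
  tendsto_zero := h.young_tendsto_zero
  left_continuous := fun t _ => h.leftContinuous_young t
  of_topBound_eq_top := fun _ => by
    have htop : youngOfInverse n G ∞ = ∞ := by
      refine top_le_iff.1 ((top_le_iff.2 ?_).trans (h.div_le_young one_pos le_top))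
      exact ENNReal.top_div_of_ne_top
        (ENNReal.mul_ne_top (by norm_num) (h.mul_ne_top one_pos))
    refine ⟨htop, ?_⟩
    have := h.leftContinuous_young ∞
    rwa [htop] at this
  of_topBound_lt_top := fun hlt => absurd h.topBound_young hlt.ne
  convex := by
    rw [h.topBound_young]
    refine ⟨fun x hx y hy a b _ _ _ => ?_, fun x _ y _ a b _ _ hab => ?_⟩
    · simp only [mem_Iio, ENNReal.smul_def, smul_eq_mul] at *
      exact ENNReal.add_lt_top.2 ⟨ENNReal.mul_lt_top (by finiteness) hx,
        ENNReal.mul_lt_top (by finiteness) hy⟩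
    · simp only [ENNReal.smul_def, smul_eq_mul]
      exact youngOfInverse_convex n G (by exact_mod_cast hab) x y
  zeroBound_eq := h.zeroBound_young
  topBound_eq := h.topBound_young
  tendsto_div_zero := h.young_div_tendsto_zero
  tendsto_div_top := h.young_div_tendsto_top

lemma genInverse_young_le (h : IsInverseProfile n G c) {r : ℝ} (hr : 0 < r) :
    genInverse (youngOfInverse n G) (ENNReal.ofReal (1 / r ^ n)) ≤ 2 * G r := by
  rw [genInverse, if_neg ENNReal.ofReal_ne_top]
  refine le_of_forall_gt fun t ht => ?_
  obtain ⟨q, hq, hqt⟩ := exists_between ht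
  refine (sInf_le ?_).trans_lt hqt
  rw [one_div, ENNReal.ofReal_inv_of_pos (by positivity)]
  exact h.lt_young hr hq

lemma le_mul_genInverse_young (h : IsInverseProfile n G c) {r : ℝ} (hr : 0 < r) :
    G r ≤ c * genInverse (youngOfInverse n G) (ENNReal.ofReal (1 / r ^ n)) := by
  have hc0 : (c : ℝ≥0∞) ≠ 0 := by exact_mod_cast (zero_lt_one.trans_le h.one_le).ne'
  rw [genInverse, if_neg ENNReal.ofReal_ne_top, mul_comm,
    ← ENNReal.div_le_iff hc0 ENNReal.coe_ne_top]
  refine le_sInf fun t ht => ?_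
  rw [ENNReal.div_le_iff hc0 ENNReal.coe_ne_top, mul_comm]
  by_contra hcon
  refine absurd (h.young_le hr (not_le.1 hcon)) (not_le.2 ?_)
  rw [← ENNReal.ofReal_inv_of_pos (by positivity), ← one_div]
  exact ht

end IsInverseProfile

/-! ### The integral of `ρ(t)/t` over `(0,r)` -/

/-- `r ↦ ∫₀ʳ ρ(t)/t dt`, with values in `[0,∞]`. -/
noncomputable def cumulative (ρ : ℝ → ℝ) (r : ℝ) : ℝ≥0∞ :=
  ∫⁻ t in Ioo (0 : ℝ) r, ENNReal.ofReal (ρ t / t)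

lemma cumulative_mono (ρ : ℝ → ℝ) : Monotone (cumulative ρ) := fun _ _ h =>
  lintegral_mono_set (Ioo_subset_Ioo_right h)

lemma lintegral_Ioo_zero_mul (f : ℝ → ℝ≥0∞) {c : ℝ} (hc : 0 < c) (r : ℝ) :
    ∫⁻ t in Ioo 0 (c * r), f t = ENNReal.ofReal c * ∫⁻ t in Ioo 0 r, f (c * t) := by
  have he : MeasurableEmbedding fun t : ℝ => c * t :=
    (Homeomorph.mulLeft₀ c hc.ne').measurableEmbedding
  have hpre : (fun t : ℝ => c * t) ⁻¹' Ioo 0 (c * r) = Ioo 0 r := by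
    ext t
    simp only [mem_preimage, mem_Ioo, mul_pos_iff_of_pos_left hc, mul_lt_mul_iff_right₀ hc]
  have hmap := Real.map_volume_mul_left hc.ne'
  have h1 : ∫⁻ t in Ioo 0 r, f (c * t)
      = ∫⁻ t in Ioo 0 (c * r), f t ∂(Measure.map (fun t : ℝ => c * t) volume) := by
    rw [he.restrict_map, he.lintegral_map, hpre]
  rw [h1, hmap, Measure.restrict_smul, lintegral_smul_measure, smul_eq_mul, ← mul_assoc,
    ← ENNReal.ofReal_mul hc.le, abs_of_pos (inv_pos.2 hc), mul_inv_cancel₀ hc.ne',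
    ENNReal.ofReal_one, one_mul]

/-- `ρ` grows at most like the power `α`, up to the factor `κ`. This is `r ↦ ρ r / r ^ α` being
almost decreasing, with `r = t` included. -/
def GrowthBound (ρ : ℝ → ℝ) (α : ℝ) (κ : ℝ≥0) : Prop :=
  ∀ r t : ℝ, 0 < r → r ≤ t → ρ t ≤ κ * (t / r) ^ α * ρ r

lemma AlmostDecreasing.exists_growthBound {ρ : ℝ → ℝ} {α : ℝ} (hρ : ∀ r, 0 < r → 0 < ρ r)
    (h : AlmostDecreasing fun r => ρ r / r ^ α) : ∃ κ : ℝ≥0, 1 ≤ κ ∧ GrowthBound ρ α κ := by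
  obtain ⟨C, hC, h⟩ := h
  refine ⟨max 1 C.toNNReal, le_max_left _ _, fun r t hr hrt => ?_⟩
  have hκ1 : (1 : ℝ) ≤ (max 1 C.toNNReal : ℝ≥0) := by exact_mod_cast le_max_left _ _
  have hκC : C ≤ (max 1 C.toNNReal : ℝ≥0) :=
    (Real.le_coe_toNNReal C).trans (by exact_mod_cast le_max_right _ _)
  set κ := max 1 C.toNNReal
  rcases hrt.eq_or_lt with rfl | hlt
  · rw [div_self hr.ne', Real.one_rpow, mul_one]
    exact le_mul_of_one_le_left (hρ r hr).le hκ1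
  · have ht : 0 < t := hr.trans hlt
    have h' := h r t hr hlt
    rw [div_le_iff₀ (by positivity)] at h'
    have h0 := hρ r hr
    calc ρ t ≤ C * (ρ r / r ^ α) * t ^ α := h'
      _ = C * (t / r) ^ α * ρ r := by rw [Real.div_rpow ht.le hr.le]; ring
      _ ≤ _ := by gcongr

namespace GrowthBound

variable {ρ : ℝ → ℝ} {α : ℝ} {κ : ℝ≥0}

lemma cumulative_le (h : GrowthBound ρ α κ) {r t : ℝ} (hr : 0 < r) (hrt : r ≤ t) :
    cumulative ρ t ≤ ENNReal.ofReal (κ * (t / r) ^ α) * cumulative ρ r := by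
  have ht : 0 < t := hr.trans_le hrt
  set c := t / r with hc
  have hc0 : 0 < c := by positivity
  have hc1 : 1 ≤ c := by rwa [hc, one_le_div hr]
  have htc : t = c * r := by rw [hc]; field_simp
  rw [cumulative, htc, lintegral_Ioo_zero_mul _ hc0, cumulative,
    ← lintegral_const_mul' _ _ ENNReal.ofReal_ne_top,
    ← lintegral_const_mul' _ _ ENNReal.ofReal_ne_top]
  refine setLIntegral_mono' measurableSet_Ioo fun u hu => ?_
  have hu0 : 0 < u := hu.1
  rw [← ENNReal.ofReal_mul hc0.le, ← ENNReal.ofReal_mul (by positivity)]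
  refine ENNReal.ofReal_le_ofReal ?_
  have h1 := h u (c * u) hu0 (by nlinarith)
  rw [mul_div_cancel_right₀ _ hu0.ne'] at h1
  calc c * (ρ (c * u) / (c * u)) = ρ (c * u) / u := by field_simp
    _ ≤ κ * c ^ α * ρ u / u := by gcongr
    _ = _ := by ring

/-- The values of `ρ` on `[a,2a]` are controlled by its average over `(a/2,a)`. -/
lemma ofReal_le_lintegral (h : GrowthBound ρ α κ) (hρ : ∀ r, 0 < r → 0 < ρ r) {a q : ℝ}
    (ha : 0 < a) (haq : a ≤ q) (hqa : q ≤ 2 * a) :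
    ENNReal.ofReal (ρ q) ≤ ENNReal.ofReal (2 * κ * 4 ^ |α|) *
      ∫⁻ t in Ioo (a / 2) a, ENNReal.ofReal (ρ t / t) := by
  have hlow : ∀ t ∈ Ioo (a / 2) a, ENNReal.ofReal (ρ q / a) ≤
      ENNReal.ofReal (κ * 4 ^ |α|) * ENNReal.ofReal (ρ t / t) := by
    intro t ht
    have ht0 : 0 < t := by linarith [ht.1]
    have hta : t ≤ a := ht.2.le
    rw [← ENNReal.ofReal_mul (by positivity)]
    refine ENNReal.ofReal_le_ofReal ?_
    have h0 := hρ t ht0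
    have h1 : 1 ≤ q / t := by rw [one_le_div ht0]; linarith
    have h4 : q / t ≤ 4 := by rw [div_le_iff₀ ht0]; linarith [ht.1]
    have hpow : (q / t) ^ α ≤ 4 ^ |α| :=
      (Real.rpow_le_rpow_of_exponent_le h1 (le_abs_self α)).trans
        (Real.rpow_le_rpow (by linarith) h4 (abs_nonneg _))
    calc ρ q / a ≤ κ * (q / t) ^ α * ρ t / a := by
          gcongr; exact h t q ht0 (by linarith)
      _ ≤ κ * 4 ^ |α| * ρ t / t := by gcongr
      _ = _ := by ring
  have hint := setLIntegral_mono' (μ := volume) measurableSet_Ioo hlow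
  rw [setLIntegral_const, lintegral_const_mul' _ _ ENNReal.ofReal_ne_top, Real.volume_Ioo,
    ← ENNReal.ofReal_mul (by have := hρ q (by linarith); positivity)] at hint
  have e : ρ q = 2 * (ρ q / a * (a - a / 2)) := by field_simp; ring
  calc ENNReal.ofReal (ρ q) = ENNReal.ofReal 2 * ENNReal.ofReal (ρ q / a * (a - a / 2)) := by
        rw [← ENNReal.ofReal_mul (by norm_num), ← e]
    _ ≤ ENNReal.ofReal 2 * (ENNReal.ofReal (κ * 4 ^ |α|) *
          ∫⁻ t in Ioo (a / 2) a, ENNReal.ofReal (ρ t / t)) := by gcongr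
    _ = _ := by rw [← mul_assoc, ← ENNReal.ofReal_mul (by norm_num), ← mul_assoc 2]

lemma cumulative_ne_zero (h : GrowthBound ρ α κ) (hρ : ∀ r, 0 < r → 0 < ρ r) {r : ℝ}
    (hr : 0 < r) : cumulative ρ r ≠ 0 := by
  intro h0
  have h1 : ∫⁻ t in Ioo (r / 2) r, ENNReal.ofReal (ρ t / t) = 0 :=
    le_antisymm ((lintegral_mono_set (Ioo_subset_Ioo_left (by positivity))).trans h0.le) zero_le
  have h2 := h.ofReal_le_lintegral hρ hr le_rfl (by linarith)
  rw [h1, mul_zero, nonpos_iff_eq_zero, ENNReal.ofReal_eq_zero] at h2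
  exact absurd (hρ r hr) (not_lt.2 h2)

lemma cumulative_ne_top (h : GrowthBound ρ α κ) (h1 : cumulative ρ 1 < ∞) (r : ℝ) :
    cumulative ρ r ≠ ∞ := by
  rcases le_total r 1 with hr | hr
  · exact ((cumulative_mono ρ hr).trans_lt h1).ne
  · exact ((h.cumulative_le one_pos hr).trans_lt
      (ENNReal.mul_lt_top ENNReal.ofReal_lt_top h1)).ne

end GrowthBound

/-- The function `r ↦ r ^ (-γ) * ∫₀ʳ ρ(t)/t dt`. -/
noncomputable def profile (ρ : ℝ → ℝ) (γ : ℝ) (r : ℝ) : ℝ≥0∞ :=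
  ENNReal.ofReal (1 / r ^ γ) * cumulative ρ r

lemma GrowthBound.profile_le {ρ : ℝ → ℝ} {γ ε : ℝ} {κ : ℝ≥0} (h : GrowthBound ρ (γ - ε) κ)
    {r t : ℝ} (hr : 0 < r) (hrt : r ≤ t) :
    profile ρ γ t ≤ ENNReal.ofReal (κ * (r / t) ^ ε) * profile ρ γ r := by
  have ht : 0 < t := hr.trans_le hrt
  calc profile ρ γ t
      ≤ ENNReal.ofReal (1 / t ^ γ) *
        (ENNReal.ofReal (κ * (t / r) ^ (γ - ε)) * cumulative ρ r) := by
        rw [profile]; gcongr; exact h.cumulative_le hr hrt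
    _ = _ := by
        rw [profile, ← mul_assoc, ← mul_assoc, ← ENNReal.ofReal_mul (by positivity),
          ← ENNReal.ofReal_mul (by positivity)]
        congr 2
        rw [Real.div_rpow ht.le hr.le, Real.div_rpow hr.le ht.le, Real.rpow_sub ht,
          Real.rpow_sub hr]
        field_simp

lemma ofReal_pow_mul_profile {ρ : ℝ → ℝ} {γ : ℝ} (n : ℕ) {r : ℝ} (hr : 0 < r) :
    ENNReal.ofReal (r ^ n) * profile ρ γ r
      = ENNReal.ofReal (r ^ ((n : ℝ) - γ)) * cumulative ρ r := by
  rw [profile, ← mul_assoc, ← ENNReal.ofReal_mul (by positivity), Real.rpow_sub hr,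
    Real.rpow_natCast, mul_one_div]

/-- `r ^ (-γ) ∫₀ʳ ρ(t)/t dt` is equivalent to `Ψ⁻¹(r ^ (-n))` for some N-function `Ψ`. -/
theorem GrowthBound.isInverseProfile {ρ : ℝ → ℝ} {γ ε : ℝ} {κ : ℝ≥0} {n : ℕ}
    (h : GrowthBound ρ (γ - ε) κ) (hκ : 1 ≤ κ) (hρ : ∀ r, 0 < r → 0 < ρ r)
    (h1 : cumulative ρ 1 < ∞) (hε : 0 < ε) (hγ : γ < n) :
    IsInverseProfile n (profile ρ γ) κ := by
  have hβ : 0 < (n : ℝ) - γ := sub_pos.2 hγ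
  have hκ0 : (0 : ℝ) < κ := by exact_mod_cast zero_lt_one.trans_le hκ
  have hc0 : ∀ r, 0 < r → cumulative ρ r ≠ 0 := fun r hr => h.cumulative_ne_zero hρ hr
  have hct : ∀ r, cumulative ρ r ≠ ∞ := h.cumulative_ne_top h1
  have hG0 : ∀ r, 0 < r → profile ρ γ r ≠ 0 := fun r hr =>
    mul_ne_zero (by rw [Ne, ENNReal.ofReal_eq_zero, not_le]; positivity) (hc0 r hr)
  have hGt : ∀ r, profile ρ γ r ≠ ∞ := fun r =>
    ENNReal.mul_ne_top ENNReal.ofReal_ne_top (hct r)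
  refine ⟨hκ, hG0, fun r _ => hGt r, ?_, ?_, ?_, ?_, ?_, ?_⟩
  · intro r t hr hrt
    refine (h.profile_le hr hrt).trans ?_
    gcongr
    have ht : 0 < t := hr.trans_le hrt
    rw [← ENNReal.ofReal_coe_nnreal]
    refine ENNReal.ofReal_le_ofReal (mul_le_of_le_one_right hκ0.le ?_)
    exact Real.rpow_le_one (by positivity) ((div_le_one ht).2 hrt) hε.le
  · intro r t hr hrt
    rw [ofReal_pow_mul_profile n hr, ofReal_pow_mul_profile n (hr.trans_le hrt)]
    gcongr
    exact cumulative_mono ρ hrt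
  · have hlow : ∀ᶠ r in 𝓝[>] (0 : ℝ),
        ENNReal.ofReal ((κ : ℝ)⁻¹ * r ^ (-ε)) * profile ρ γ 1 ≤ profile ρ γ r := by
      filter_upwards [self_mem_nhdsWithin, mem_nhdsWithin_of_mem_nhds (Iio_mem_nhds one_pos)]
        with r hr0 hr1
      have hr0 : 0 < r := hr0
      calc _ ≤ ENNReal.ofReal ((κ : ℝ)⁻¹ * r ^ (-ε)) *
            (ENNReal.ofReal (κ * (r / 1) ^ ε) * profile ρ γ r) := by
            gcongr; exact h.profile_le hr0 (le_of_lt hr1)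
        _ = profile ρ γ r := by
            rw [← mul_assoc, ← ENNReal.ofReal_mul (by positivity), div_one, Real.rpow_neg hr0.le]
            have : (κ : ℝ)⁻¹ * (r ^ ε)⁻¹ * (κ * r ^ ε) = 1 := by
              have : r ^ ε ≠ 0 := by positivity
              field_simp
            rw [this, ENNReal.ofReal_one, one_mul]
    refine tendsto_nhds_top_mono ?_ hlow
    have ht : Tendsto (fun r : ℝ => (κ : ℝ)⁻¹ * r ^ (-ε)) (𝓝[>] 0) atTop :=
      (tendsto_rpow_neg_nhdsGT_zero (by linarith)).const_mul_atTop (by positivity)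
    have := ENNReal.Tendsto.mul_const (b := profile ρ γ 1) (ENNReal.tendsto_ofReal_atTop.comp ht)
      (Or.inl ENNReal.top_ne_zero)
    rwa [ENNReal.top_mul (hG0 1 one_pos)] at this
  · have hup : ∀ᶠ r in atTop,
        profile ρ γ r ≤ ENNReal.ofReal (κ * r ^ (-ε)) * profile ρ γ 1 := by
      filter_upwards [eventually_ge_atTop 1] with r hr
      refine (h.profile_le one_pos hr).trans_eq ?_
      rw [one_div, Real.inv_rpow (by linarith), Real.rpow_neg (by linarith)]
    refine tendsto_of_tendsto_of_tendsto_of_le_of_le' tendsto_const_nhds ?_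
      (Eventually.of_forall fun _ => zero_le) hup
    have := ENNReal.Tendsto.mul_const (b := profile ρ γ 1)
      (ENNReal.tendsto_ofReal ((tendsto_rpow_neg_atTop hε).const_mul (κ : ℝ))) (Or.inr (hGt 1))
    simpa using this
  · have hup : ∀ᶠ r in 𝓝[>] (0 : ℝ), ENNReal.ofReal (r ^ n) * profile ρ γ r
        ≤ ENNReal.ofReal (r ^ ((n : ℝ) - γ)) * cumulative ρ 1 := by
      filter_upwards [self_mem_nhdsWithin, mem_nhdsWithin_of_mem_nhds (Iio_mem_nhds one_pos)]
        with r hr0 hr1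
      rw [ofReal_pow_mul_profile n hr0]
      gcongr
      exact cumulative_mono ρ (le_of_lt hr1)
    refine tendsto_of_tendsto_of_tendsto_of_le_of_le' tendsto_const_nhds ?_
      (Eventually.of_forall fun _ => zero_le) hup
    have ht : Tendsto (fun r : ℝ => r ^ ((n : ℝ) - γ)) (𝓝[>] 0) (𝓝 0) := by
      have := (Real.continuousAt_rpow_const 0 ((n : ℝ) - γ) (Or.inr hβ.le)).tendsto
      rw [Real.zero_rpow hβ.ne'] at this
      exact this.mono_left nhdsWithin_le_nhds
    have := ENNReal.Tendsto.mul_const (b := cumulative ρ 1)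
      (ENNReal.tendsto_ofReal ht) (Or.inr (hct 1))
    simpa using this
  · have hlow : ∀ᶠ r in atTop, ENNReal.ofReal (r ^ ((n : ℝ) - γ)) * cumulative ρ 1
        ≤ ENNReal.ofReal (r ^ n) * profile ρ γ r := by
      filter_upwards [eventually_ge_atTop 1] with r hr
      rw [ofReal_pow_mul_profile n (by linarith)]
      gcongr
      exact cumulative_mono ρ hr
    refine tendsto_nhds_top_mono ?_ hlow
    have := ENNReal.Tendsto.mul_const (b := cumulative ρ 1)
      (ENNReal.tendsto_ofReal_atTop.comp (tendsto_rpow_atTop hβ)) (Or.inl ENNReal.top_ne_zero)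
    rwa [ENNReal.top_mul (hc0 1 one_pos)] at this

/-! ### The pointwise bound of Hedberg type -/

section Hedberg

variable {E : Type*} [NormedAddCommGroup E] [NormedSpace ℝ E] [MeasurableSpace E]
  (μ : Measure E)

/-- The integral of `ρ(|x-y|) |x-y| ^ (-dim E) F(y)` for `F : E → [0,∞]`. -/
noncomputable def potential (ρ : ℝ → ℝ) (F : E → ℝ≥0∞) (x : E) : ℝ≥0∞ :=
  ∫⁻ y, ENNReal.ofReal (ρ ‖x - y‖ / ‖x - y‖ ^ Module.finrank ℝ E) * F y ∂μ

variable [BorelSpace E] {ρ : ℝ → ℝ} {α : ℝ} {κ : ℝ≥0}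

lemma GrowthBound.lintegral_annulus_le (h : GrowthBound ρ α κ) (hρ : ∀ r, 0 < r → 0 < ρ r)
    {F : E → ℝ≥0∞} (hF : Measurable F) (x : E) {q : ℝ} (hq : 0 < q) :
    ∫⁻ y in {y | ‖x - y‖ ∈ Ico q (2 * q)},
        ENNReal.ofReal (ρ ‖x - y‖ / ‖x - y‖ ^ Module.finrank ℝ E) * F y ∂μ
      ≤ ENNReal.ofReal (2 * κ * 4 ^ |α|) * (∫⁻ t in Ioo (q / 2) q, ENNReal.ofReal (ρ t / t)) *
        (ENNReal.ofReal (1 / q ^ Module.finrank ℝ E) * ∫⁻ y in Metric.ball x (2 * q), F y ∂μ) := by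
  set d := Module.finrank ℝ E
  have hmeas : MeasurableSet {y | ‖x - y‖ ∈ Ico q (2 * q)} :=
    measurableSet_Ico.preimage (by fun_prop)
  set K := ENNReal.ofReal (2 * κ * 4 ^ |α|) * ∫⁻ t in Ioo (q / 2) q, ENNReal.ofReal (ρ t / t)
  calc _ ≤ ∫⁻ y in {y | ‖x - y‖ ∈ Ico q (2 * q)}, K * ENNReal.ofReal (1 / q ^ d) * F y ∂μ := by
        refine setLIntegral_mono' hmeas fun y hy => ?_
        have hy0 : 0 < ‖x - y‖ := hq.trans_le hy.1
        gcongr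
        calc ENNReal.ofReal (ρ ‖x - y‖ / ‖x - y‖ ^ d)
            ≤ ENNReal.ofReal (ρ ‖x - y‖ * (1 / q ^ d)) := by
              refine ENNReal.ofReal_le_ofReal ?_
              have := (hρ _ hy0).le
              rw [mul_one_div]
              gcongr
              exact hy.1
          _ = ENNReal.ofReal (ρ ‖x - y‖) * ENNReal.ofReal (1 / q ^ d) :=
              ENNReal.ofReal_mul (hρ _ hy0).le
          _ ≤ _ := by gcongr; exact h.ofReal_le_lintegral hρ hq hy.1 hy.2.le
    _ = K * ENNReal.ofReal (1 / q ^ d) * ∫⁻ y in {y | ‖x - y‖ ∈ Ico q (2 * q)}, F y ∂μ :=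
        lintegral_const_mul _ hF
    _ ≤ K * ENNReal.ofReal (1 / q ^ d) * ∫⁻ y in Metric.ball x (2 * q), F y ∂μ := by
        refine mul_le_mul_right (lintegral_mono_set fun y hy => ?_) _
        rw [Metric.mem_ball, dist_comm, dist_eq_norm]
        exact hy.2
    _ = _ := mul_assoc _ _ _

/-- The part of the potential near `x`: the dyadic annuli contribute averages of `F` weighted by
the integrals of `ρ(t)/t` over disjoint intervals. -/
lemma GrowthBound.lintegral_near_le (h : GrowthBound ρ α κ) (hρ : ∀ r, 0 < r → 0 < ρ r)
    {F : E → ℝ≥0∞} (hF : Measurable F) (x : E) {r : ℝ} (hr : 0 < r) :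
    ∫⁻ y in {y | ‖x - y‖ ∈ Ioo 0 r},
        ENNReal.ofReal (ρ ‖x - y‖ / ‖x - y‖ ^ Module.finrank ℝ E) * F y ∂μ
      ≤ ENNReal.ofReal (2 * κ * 4 ^ |α|) * 2 ^ Module.finrank ℝ E *
        (cumulative ρ r * maximalFunction μ F x) := by
  set d := Module.finrank ℝ E with hd
  set q : ℕ → ℝ := fun i => r * (1 / 2) ^ (i + 1) with hq
  have hq0 : ∀ i, 0 < q i := fun i => by positivity
  have hcover : {y : E | ‖x - y‖ ∈ Ioo 0 r} ⊆ ⋃ i, {y | ‖x - y‖ ∈ Ico (q i) (2 * q i)} := by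
    intro y hy
    obtain ⟨hy0, hyr⟩ : 0 < ‖x - y‖ ∧ ‖x - y‖ < r := hy
    obtain ⟨i, hi1, hi2⟩ := exists_nat_pow_near_of_lt_one (x := ‖x - y‖ / r) (y := (1 / 2 : ℝ))
      (by positivity) ((div_le_one hr).2 hyr.le) (by norm_num) (by norm_num)
    rw [lt_div_iff₀ hr] at hi1
    rw [div_le_iff₀ hr] at hi2
    rcases hi2.lt_or_eq with hlt | heq
    · refine mem_iUnion.2 ⟨i, ?_, ?_⟩
      · simp only [hq]; linarith
      · simp only [hq, pow_succ]; linarith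
    · -- The left end point of an annulus belongs to the next larger annulus.
      rcases i with _ | i
      · simp only [pow_zero, one_mul] at heq; exact absurd heq hyr.ne
      · refine mem_iUnion.2 ⟨i, ?_, ?_⟩
        · simp only [hq]; linarith
        · simp only [hq]; linarith [hq0 i]
  have hanti : Antitone fun i : ℕ => r * (1 / 2 : ℝ) ^ (i + 1) := by
    intro i j hij
    refine mul_le_mul_of_nonneg_left ?_ hr.le
    exact pow_le_pow_of_le_one (by norm_num) (by norm_num) (by omega)
  have hdisj : Pairwise (Function.onFun Disjoint fun i : ℕ => Ioo (q i / 2) (q i)) := by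
    have e : ∀ i, q i / 2 = q (i + 1) := fun i => by simp only [hq, pow_succ]; ring
    simp only [e]
    exact hanti.pairwise_disjoint_on_Ioo_succ
  have hsum : ∑' i, ∫⁻ t in Ioo (q i / 2) (q i), ENNReal.ofReal (ρ t / t) ≤ cumulative ρ r := by
    rw [← lintegral_iUnion (fun i => measurableSet_Ioo) hdisj]
    refine lintegral_mono_set (iUnion_subset fun i =>
      Ioo_subset_Ioo (by have := hq0 i; positivity) ?_)
    have : (1 / 2 : ℝ) ^ (i + 1) ≤ 1 := pow_le_one₀ (by norm_num) (by norm_num)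
    simp only [hq]; nlinarith
  calc _ ≤ ∑' i, ∫⁻ y in {y | ‖x - y‖ ∈ Ico (q i) (2 * q i)},
        ENNReal.ofReal (ρ ‖x - y‖ / ‖x - y‖ ^ d) * F y ∂μ :=
        (lintegral_mono_set hcover).trans (lintegral_iUnion_le _ _)
    _ ≤ ∑' i, ENNReal.ofReal (2 * κ * 4 ^ |α|) * 2 ^ d * maximalFunction μ F x *
          ∫⁻ t in Ioo (q i / 2) (q i), ENNReal.ofReal (ρ t / t) := by
        refine ENNReal.tsum_le_tsum fun i => (h.lintegral_annulus_le μ hρ hF x (hq0 i)).trans ?_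
        have hM := lintegral_ball_le_maximalFunction μ F x (r := 2 * q i)
          (by have := hq0 i; positivity)
        calc _ ≤ ENNReal.ofReal (2 * κ * 4 ^ |α|) *
              (∫⁻ t in Ioo (q i / 2) (q i), ENNReal.ofReal (ρ t / t)) *
              (ENNReal.ofReal (1 / q i ^ d) *
                (ENNReal.ofReal ((2 * q i) ^ d) * maximalFunction μ F x)) := by gcongr
          _ = _ := by
            have e : ENNReal.ofReal (1 / q i ^ d) * ENNReal.ofReal ((2 * q i) ^ d) = 2 ^ d := by
              have := hq0 i
              rw [← ENNReal.ofReal_mul (by positivity), mul_pow 2 (q i) d,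
                show 1 / q i ^ d * (2 ^ d * q i ^ d) = 2 ^ d by field_simp,
                ENNReal.ofReal_pow (by norm_num)]
              norm_num
            rw [← mul_assoc (ENNReal.ofReal (1 / q i ^ d)), e]; ring
    _ ≤ ENNReal.ofReal (2 * κ * 4 ^ |α|) * 2 ^ d * maximalFunction μ F x * cumulative ρ r := by
        rw [ENNReal.tsum_mul_left]; gcongr
    _ = _ := by ring

variable [FiniteDimensional ℝ E] [Nontrivial E] [μ.IsAddHaarMeasure]

lemma lintegral_ball_le_holder {s : ℝ} (hs : 1 < s) {F : E → ℝ≥0∞} (hF : Measurable F) (x : E)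
    {r : ℝ} (hr : 0 < r) :
    ∫⁻ y in Metric.ball x r, F y ∂μ ≤
      ENNReal.ofReal (r ^ ((Module.finrank ℝ E : ℝ) - Module.finrank ℝ E / s)) *
        μ (Metric.ball 0 1) ^ (1 - 1 / s) * (∫⁻ y, F y ^ s ∂μ) ^ (1 / s) := by
  set d := Module.finrank ℝ E
  have hconj := Real.HolderConjugate.conjExponent hs
  have hq : 1 / Real.conjExponent s = 1 - 1 / s := by
    have := hconj.inv_add_inv_eq_one
    rw [one_div, one_div]; linarith
  have hq0 : 0 ≤ 1 - 1 / s := by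
    rw [sub_nonneg, div_le_one (by linarith)]; exact hs.le
  have h := ENNReal.lintegral_mul_le_Lp_mul_Lq (μ.restrict (Metric.ball x r)) hconj
    hF.aemeasurable (measurable_const (a := (1 : ℝ≥0∞))).aemeasurable
  simp only [Pi.mul_apply, mul_one, ENNReal.one_rpow, lintegral_const,
    Measure.restrict_apply_univ, one_mul, hq] at h
  refine h.trans ?_
  rw [mul_comm, Measure.addHaar_ball μ x hr.le, ENNReal.mul_rpow_of_nonneg _ _ hq0,
    ENNReal.ofReal_rpow_of_nonneg (by positivity) hq0, ← Real.rpow_natCast,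
    ← Real.rpow_mul hr.le, mul_sub, mul_one, mul_one_div]
  gcongr
  exact Measure.restrict_le_self

/-- The part of the potential away from `x`: Hölder's inequality on the dyadic annuli gives a
geometric series with ratio `2 ^ (-ε)`. -/
lemma GrowthBound.lintegral_far_le {s ε : ℝ} (hs : 1 < s)
    (h : GrowthBound ρ (Module.finrank ℝ E / s - ε) κ) (hρ : ∀ r, 0 < r → 0 < ρ r)
    {F : E → ℝ≥0∞} (hF : Measurable F) (x : E) {r : ℝ} (hr : 0 < r) :
    ∫⁻ y in {y | ‖x - y‖ ∈ Ici r},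
        ENNReal.ofReal (ρ ‖x - y‖ / ‖x - y‖ ^ Module.finrank ℝ E) * F y ∂μ
      ≤ ENNReal.ofReal (2 * κ * 4 ^ |Module.finrank ℝ E / s - ε|) *
        (ENNReal.ofReal (κ * 2 ^ ((Module.finrank ℝ E : ℝ) - Module.finrank ℝ E / s)) *
          μ (Metric.ball 0 1) ^ (1 - 1 / s) * (1 - ENNReal.ofReal (2 ^ (-ε)))⁻¹) *
        (cumulative ρ r * (ENNReal.ofReal (1 / r ^ (Module.finrank ℝ E / s)) *
          (∫⁻ y, F y ^ s ∂μ) ^ (1 / s))) := by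
  set d := Module.finrank ℝ E with hd
  set K := ENNReal.ofReal (2 * κ * 4 ^ |d / s - ε|)
  set N := (∫⁻ y, F y ^ s ∂μ) ^ (1 / s)
  set B := μ (Metric.ball (0 : E) 1) ^ (1 - 1 / s)
  set q : ℕ → ℝ := fun i => 2 ^ i * r with hq
  have hq0 : ∀ i, 0 < q i := fun i => by positivity
  have hcover : {y : E | ‖x - y‖ ∈ Ici r} ⊆ ⋃ i, {y | ‖x - y‖ ∈ Ico (q i) (2 * q i)} := by
    intro y hy
    have hy : r ≤ ‖x - y‖ := hy
    obtain ⟨i, hi1, hi2⟩ := exists_nat_pow_near (x := ‖x - y‖ / r) (y := (2 : ℝ))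
      ((one_le_div hr).2 hy) (by norm_num)
    rw [le_div_iff₀ hr] at hi1
    rw [div_lt_iff₀ hr, pow_succ] at hi2
    refine mem_iUnion.2 ⟨i, hi1, ?_⟩
    simp only [hq]; linarith
  have hterm : ∀ i, ∫⁻ y in {y | ‖x - y‖ ∈ Ico (q i) (2 * q i)},
      ENNReal.ofReal (ρ ‖x - y‖ / ‖x - y‖ ^ d) * F y ∂μ ≤
      K * (ENNReal.ofReal (κ * 2 ^ ((d : ℝ) - d / s)) * B) *
        (cumulative ρ r * (ENNReal.ofReal (1 / r ^ (d / s)) * N)) *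
        ENNReal.ofReal (2 ^ (-ε)) ^ i := by
    intro i
    have hqi := hq0 i
    have hrq : r ≤ q i := le_mul_of_one_le_left hr.le (one_le_pow₀ (by norm_num))
    have hR : ∫⁻ t in Ioo (q i / 2) (q i), ENNReal.ofReal (ρ t / t) ≤
        ENNReal.ofReal (κ * (q i / r) ^ (d / s - ε)) * cumulative ρ r :=
      (lintegral_mono_set (Ioo_subset_Ioo_left (by positivity))).trans (h.cumulative_le hr hrq)
    have hB := lintegral_ball_le_holder μ hs hF x (r := 2 * q i) (by positivity)
    have e : ENNReal.ofReal (κ * (q i / r) ^ (d / s - ε)) * (ENNReal.ofReal (1 / q i ^ d) *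
        ENNReal.ofReal ((2 * q i) ^ ((d : ℝ) - d / s))) =
        ENNReal.ofReal (κ * 2 ^ ((d : ℝ) - d / s)) * (ENNReal.ofReal (1 / r ^ (d / s)) *
          ENNReal.ofReal (2 ^ (-ε)) ^ i) := by
      rw [← ENNReal.ofReal_pow (by positivity), ← ENNReal.ofReal_mul (by positivity),
        ← ENNReal.ofReal_mul (by positivity), ← ENNReal.ofReal_mul (by positivity),
        ← ENNReal.ofReal_mul (by positivity)]
      congr 1
      have e1 : q i / r = 2 ^ i := by simp only [hq]; field_simp
      have e2 : ((2 : ℝ) ^ (-ε)) ^ i = (2 ^ i) ^ (-ε) := by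
        rw [← Real.rpow_natCast, ← Real.rpow_natCast, ← Real.rpow_mul (by norm_num),
          ← Real.rpow_mul (by norm_num), mul_comm]
      have e3 : q i ^ ((d : ℝ) - d / s) = q i ^ d / ((2 ^ i) ^ (d / s) * r ^ (d / s)) := by
        rw [Real.rpow_sub hqi, Real.rpow_natCast, ← Real.mul_rpow (by positivity) hr.le]
      have e4 : ((2 : ℝ) ^ i) ^ (d / s - ε) = (2 ^ i) ^ (d / s) * (2 ^ i) ^ (-ε) := by
        rw [← Real.rpow_add (by positivity), sub_eq_add_neg]
      rw [Real.mul_rpow (by norm_num) hqi.le, e1, e2, e3, e4]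
      field_simp
    calc _ ≤ _ := h.lintegral_annulus_le μ hρ hF x hqi
      _ ≤ K * (ENNReal.ofReal (κ * (q i / r) ^ (d / s - ε)) * cumulative ρ r) *
          (ENNReal.ofReal (1 / q i ^ d) *
            (ENNReal.ofReal ((2 * q i) ^ ((d : ℝ) - d / s)) * B * N)) := by
          gcongr
      _ = K * (ENNReal.ofReal (κ * (q i / r) ^ (d / s - ε)) * (ENNReal.ofReal (1 / q i ^ d) *
            ENNReal.ofReal ((2 * q i) ^ ((d : ℝ) - d / s)))) * B * N * cumulative ρ r := by ring
      _ = _ := by rw [e]; ring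
  calc _ ≤ ∑' i, ∫⁻ y in {y | ‖x - y‖ ∈ Ico (q i) (2 * q i)},
        ENNReal.ofReal (ρ ‖x - y‖ / ‖x - y‖ ^ d) * F y ∂μ :=
        (lintegral_mono_set hcover).trans (lintegral_iUnion_le _ _)
    _ ≤ _ := ENNReal.tsum_le_tsum hterm
    _ = _ := by rw [ENNReal.tsum_mul_left, ENNReal.tsum_geometric]; ring

/-- Hedberg's inequality for the kernel `ρ(|x|) |x| ^ (-dim E)`. -/
theorem GrowthBound.exists_potential_le {s ε : ℝ} (hs : 1 < s) (hε : 0 < ε)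
    (h : GrowthBound ρ (Module.finrank ℝ E / s - ε) κ) (hρ : ∀ r, 0 < r → 0 < ρ r) :
    ∃ C : ℝ≥0, 1 ≤ C ∧ ∀ F : E → ℝ≥0∞, Measurable F → ∀ x, ∀ r, 0 < r →
      potential μ ρ F x ≤ C * (cumulative ρ r * (maximalFunction μ F x +
        ENNReal.ofReal (1 / r ^ (Module.finrank ℝ E / s)) * (∫⁻ y, F y ^ s ∂μ) ^ (1 / s))) := by
  set d := Module.finrank ℝ E with hd
  set K₁ : ℝ≥0∞ := ENNReal.ofReal (2 * κ * 4 ^ |d / s - ε|) * 2 ^ d with hK₁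
  set K₂ : ℝ≥0∞ := ENNReal.ofReal (2 * κ * 4 ^ |d / s - ε|) *
    (ENNReal.ofReal (κ * 2 ^ ((d : ℝ) - d / s)) *
      μ (Metric.ball 0 1) ^ (1 - 1 / s) * (1 - ENNReal.ofReal (2 ^ (-ε)))⁻¹) with hK₂
  have hq0 : 0 ≤ 1 - 1 / s := by
    rw [sub_nonneg, div_le_one (by linarith)]; exact hs.le
  have h2 : ENNReal.ofReal (2 ^ (-ε)) < 1 := by
    rw [← ENNReal.ofReal_one, ENNReal.ofReal_lt_ofReal_iff one_pos]
    exact Real.rpow_lt_one_of_one_lt_of_neg one_lt_two (neg_lt_zero.2 hε)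
  have hK₁t : K₁ ≠ ∞ := by rw [hK₁]; finiteness
  have hK₂t : K₂ ≠ ∞ := by
    refine ENNReal.mul_ne_top ENNReal.ofReal_ne_top (ENNReal.mul_ne_top
      (ENNReal.mul_ne_top ENNReal.ofReal_ne_top
        (ENNReal.rpow_ne_top_of_nonneg hq0 measure_ball_lt_top.ne)) ?_)
    exact ENNReal.inv_ne_top.2 (tsub_pos_of_lt h2).ne'
  set C : ℝ≥0 := 1 + (K₁.toNNReal + K₂.toNNReal) with hC
  have hC₁ : K₁ ≤ C := by
    rw [← ENNReal.coe_toNNReal hK₁t, ENNReal.coe_le_coe]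
    exact le_self_add.trans le_add_self
  have hC₂ : K₂ ≤ C := by
    rw [← ENNReal.coe_toNNReal hK₂t, ENNReal.coe_le_coe]
    exact le_add_self.trans le_add_self
  refine ⟨C, le_self_add, fun F hF x r hr => ?_⟩
  have hcover : ({x}ᶜ : Set E) ⊆ {y | ‖x - y‖ ∈ Ioo 0 r} ∪ {y | ‖x - y‖ ∈ Ici r} := by
    intro y hy
    have hxy : 0 < ‖x - y‖ := norm_pos_iff.2 (sub_ne_zero.2 (Ne.symm hy))
    rcases lt_or_ge ‖x - y‖ r with hlt | hge
    · exact Or.inl ⟨hxy, hlt⟩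
    · exact Or.inr hge
  calc potential μ ρ F x
      = ∫⁻ y in {x}ᶜ, ENNReal.ofReal (ρ ‖x - y‖ / ‖x - y‖ ^ d) * F y ∂μ := by
        rw [restrict_compl_singleton]; rfl
    _ ≤ _ := (lintegral_mono_set hcover).trans (lintegral_union_le _ _ _)
    _ ≤ K₁ * (cumulative ρ r * maximalFunction μ F x) + K₂ * (cumulative ρ r *
          (ENNReal.ofReal (1 / r ^ (d / s)) * (∫⁻ y, F y ^ s ∂μ) ^ (1 / s))) :=
        add_le_add (h.lintegral_near_le μ hρ hF x hr) (h.lintegral_far_le μ hs hρ hF x hr)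
    _ ≤ C * (cumulative ρ r * maximalFunction μ F x) + C * (cumulative ρ r *
          (ENNReal.ofReal (1 / r ^ (d / s)) * (∫⁻ y, F y ^ s ∂μ) ^ (1 / s))) := by gcongr
    _ = _ := by ring

end Hedberg

/-! ### Measurability of the kernel -/

/-- The points whose norm lies in a null set of radii form a null set. -/
lemma ae_norm_of_ae_restrict_Ioi {E : Type*} [NormedAddCommGroup E] [NormedSpace ℝ E]
    [MeasurableSpace E] [BorelSpace E] [FiniteDimensional ℝ E] [Nontrivial E] (μ : Measure E)
    [μ.IsAddHaarMeasure] {p : ℝ → Prop} (hp : ∀ᵐ t ∂(volume.restrict (Ioi (0 : ℝ))), p t) :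
    ∀ᵐ x ∂μ, p ‖x‖ := by
  classical
  set f : ℝ → ℝ := fun t => if p t then 0 else 1 with hf
  have hf0 : (fun t : ℝ => t ^ (Module.finrank ℝ E - 1) • f t)
      =ᵐ[volume.restrict (Ioi (0 : ℝ))] 0 := by
    filter_upwards [hp] with t ht
    simp [hf, ht]
  have hint : Integrable (fun x : E => f ‖x‖) μ := by
    rw [integrable_fun_norm_addHaar μ]
    exact (integrable_congr hf0).2 (integrable_zero _ _ _)
  have hzero : ∫ x, f ‖x‖ ∂μ = 0 := by
    rw [integral_fun_norm_addHaar μ, integral_congr_ae hf0]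
    simp
  have hnn : 0 ≤ fun x : E => f ‖x‖ := fun x => by
    simp only [hf, Pi.zero_apply]; split_ifs <;> norm_num
  filter_upwards [(integral_eq_zero_iff_of_nonneg hnn hint).1 hzero] with x hx
  by_contra hcon
  simp [hf, hcon] at hx

section Operator

variable {n : ℕ} {ρ : ℝ → ℝ} {f : EuclideanSpace ℝ (Fin n) → ℂ}

lemma exists_stronglyMeasurable_fracIntegrand [Nontrivial (EuclideanSpace ℝ (Fin n))]
    (hρ : AEMeasurable ρ (volume.restrict (Ioi (0 : ℝ)))) (hf : AEStronglyMeasurable f volume) :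
    ∃ k : EuclideanSpace ℝ (Fin n) → EuclideanSpace ℝ (Fin n) → ℂ,
      StronglyMeasurable (Function.uncurry k) ∧ ∀ x, fracIntegrand ρ f x =ᵐ[volume] k x := by
  refine ⟨fracIntegrand (hρ.mk ρ) (hf.mk f), ?_, fun x => ?_⟩
  · have h1 : Measurable fun z : EuclideanSpace ℝ (Fin n) × EuclideanSpace ℝ (Fin n) =>
        ((hρ.mk ρ ‖z.1 - z.2‖ / ‖z.1 - z.2‖ ^ n : ℝ) : ℂ) := by
      have := hρ.measurable_mk
      fun_prop
    have h2 : Measurable fun z : EuclideanSpace ℝ (Fin n) × EuclideanSpace ℝ (Fin n) =>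
        hf.mk f z.2 := hf.stronglyMeasurable_mk.measurable.comp measurable_snd
    exact (h1.mul h2).stronglyMeasurable
  · have h1 := (Measure.measurePreserving_sub_left volume x).quasiMeasurePreserving.ae
      (ae_norm_of_ae_restrict_Ioi volume hρ.ae_eq_mk)
    filter_upwards [h1, hf.ae_eq_mk] with y hy1 hy2
    rw [fracIntegrand, fracIntegrand, hy1, hy2]

lemma aestronglyMeasurable_fracIntegrand [Nontrivial (EuclideanSpace ℝ (Fin n))]
    (hρ : AEMeasurable ρ (volume.restrict (Ioi (0 : ℝ)))) (hf : AEStronglyMeasurable f volume)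
    (x : EuclideanSpace ℝ (Fin n)) : AEStronglyMeasurable (fracIntegrand ρ f x) volume := by
  obtain ⟨k, hk, h⟩ := exists_stronglyMeasurable_fracIntegrand hρ hf
  exact ⟨k x, hk.comp_measurable measurable_prodMk_left, h x⟩

lemma stronglyMeasurable_fracIntegral [Nontrivial (EuclideanSpace ℝ (Fin n))]
    (hρ : AEMeasurable ρ (volume.restrict (Ioi (0 : ℝ)))) (hf : AEStronglyMeasurable f volume) :
    StronglyMeasurable (fracIntegral ρ f) := by
  obtain ⟨k, hk, h⟩ := exists_stronglyMeasurable_fracIntegrand hρ hf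
  have : fracIntegral ρ f = fun x => ∫ y, k x y := funext fun x => integral_congr_ae (h x)
  rw [this]
  exact hk.integral_prod_right

lemma lintegral_enorm_fracIntegrand_le {F : EuclideanSpace ℝ (Fin n) → ℝ≥0∞}
    (hn : n ≠ 0) (hρ : ∀ r, 0 < r → 0 < ρ r) (hF : ∀ᵐ y, ‖f y‖ₑ = F y)
    (x : EuclideanSpace ℝ (Fin n)) :
    ∫⁻ y, ‖fracIntegrand ρ f x y‖ₑ ≤ potential volume ρ F x := by
  refine lintegral_mono_ae ?_
  filter_upwards [hF] with y hy
  have h0 : 0 ≤ ρ ‖x - y‖ / ‖x - y‖ ^ n := by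
    rcases (norm_nonneg (x - y)).eq_or_lt with h | h
    · rw [← h, zero_pow hn, div_zero]
    · exact div_nonneg (hρ _ h).le (by positivity)
  rw [fracIntegrand, enorm_mul, hy, finrank_euclideanSpace_fin, ← ofReal_norm, Complex.norm_real,
    Real.norm_of_nonneg h0]

/-! ### Boundedness of the operator -/

/-- Hedberg's inequality, with the radius chosen so that its two terms balance, bounds the Young
function of the normalised potential by a power of the maximal function. -/
lemma young_potential_le {s : ℝ} (hs : 1 < s) {κ C : ℝ≥0} (hn : n ≠ 0)
    (hG : IsInverseProfile n (profile ρ (n / s)) κ) (hC : 1 ≤ C) {T M N : ℝ≥0∞}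
    (hN0 : N ≠ 0) (hNt : N ≠ ∞)
    (hT : ∀ r : ℝ, 0 < r →
      T ≤ C * (cumulative ρ r * (M + ENNReal.ofReal (1 / r ^ ((n : ℝ) / s)) * N))) :
    youngOfInverse n (profile ρ (n / s)) (T / (4 * κ * C * N)) ≤ (M / N) ^ s := by
  have hs0 : 0 < s := by linarith
  have hn0 : (0 : ℝ) < n := by exact_mod_cast Nat.pos_of_ne_zero hn
  have hκ0 : (κ : ℝ≥0∞) ≠ 0 := by exact_mod_cast (zero_lt_one.trans_le hG.one_le).ne'
  have hC0 : (C : ℝ≥0∞) ≠ 0 := by exact_mod_cast (zero_lt_one.trans_le hC).ne'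
  refine le_of_forall_gt_imp_ge_of_dense fun a ha => ?_
  rcases eq_or_ne a ∞ with rfl | hat
  · exact le_top
  have ha0 : a ≠ 0 := (zero_le.trans_lt ha).ne'
  -- The radius with `r ^ (-n) = a`.
  set r : ℝ := a.toReal ^ (-(1 / (n : ℝ))) with hr
  have har : 0 < a.toReal := ENNReal.toReal_pos ha0 hat
  have hr0 : 0 < r := Real.rpow_pos_of_pos har _
  have hrn : (ENNReal.ofReal (r ^ n))⁻¹ = a := by
    rw [← ENNReal.ofReal_inv_of_pos (by positivity), hr, ← Real.rpow_natCast,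
      ← Real.rpow_mul har.le,
      neg_mul, one_div, inv_mul_cancel₀ hn0.ne', Real.rpow_neg har.le, inv_inv, Real.rpow_one,
      ENNReal.ofReal_toReal hat]
  set m : ℝ≥0∞ := ENNReal.ofReal (1 / r ^ ((n : ℝ) / s)) with hm
  have hma : m = a ^ (1 / s) := by
    conv_rhs => rw [← ENNReal.ofReal_toReal hat]
    rw [ENNReal.ofReal_rpow_of_pos har, hm, hr, ← Real.rpow_mul har.le, one_div (_ ^ _),
      ← Real.rpow_neg har.le]
    congr 2
    field_simp
  have hMm : M ≤ m * N := by
    rw [← ENNReal.div_le_iff hN0 hNt, hma]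
    have := ENNReal.rpow_le_rpow ha.le (by positivity : 0 ≤ 1 / s)
    rwa [← ENNReal.rpow_mul, mul_one_div_cancel hs0.ne', ENNReal.rpow_one] at this
  rw [← hrn]
  refine hG.young_le hr0 ?_
  have hGr0 := hG.ne_zero r hr0
  have hGrt := hG.ne_top r hr0
  set g := profile ρ (n / s) r with hg
  have hTg : T ≤ 2 * C * N * g := by
    calc T ≤ C * (cumulative ρ r * (m * N + m * N)) := (hT r hr0).trans (by gcongr)
      _ = _ := by rw [hg, profile]; ring
  have hD0 : 4 * κ * C * N ≠ 0 :=
    mul_ne_zero (mul_ne_zero (mul_ne_zero (by norm_num) hκ0) hC0) hN0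
  have hDt : 4 * κ * C * N ≠ ∞ := by finiteness
  calc κ * (T / (4 * κ * C * N)) ≤ κ * (2 * C * N * g / (4 * κ * C * N)) := by gcongr
    _ = g / 2 := by
      rw [← mul_div_assoc, ENNReal.div_eq_div_iff (by norm_num) (by norm_num) hD0 hDt]
      ring
    _ < g := ENNReal.half_lt_self hGr0 hGrt

/-- The maximal theorem integrates the pointwise bound `young_potential_le`; the resulting constant
is absorbed into the norm by `Ψ (a t) ≤ a Ψ t` for `a ≤ 1`. -/
theorem fracIntegralBounded_young [Nontrivial (EuclideanSpace ℝ (Fin n))] {s ε : ℝ} (hs : 1 < s)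
    (hε : 0 < ε) {κ : ℝ≥0} (hn : n ≠ 0) (hρ : ∀ r, 0 < r → 0 < ρ r)
    (hρm : AEMeasurable ρ (volume.restrict (Ioi (0 : ℝ))))
    (h : GrowthBound ρ (n / s - ε) κ) (hG : IsInverseProfile n (profile ρ (n / s)) κ) :
    FracIntegralBounded n ρ s (youngOfInverse n (profile ρ (n / s))) := by
  have hs0 : 0 < s := by linarith
  set Ψ := youngOfInverse n (profile ρ (n / s)) with hΨ
  have hd : Module.finrank ℝ (EuclideanSpace ℝ (Fin n)) = n := finrank_euclideanSpace_fin
  obtain ⟨C, hC1, hC⟩ := GrowthBound.exists_potential_le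
    (volume : Measure (EuclideanSpace ℝ (Fin n))) hs hε (by rwa [hd]) hρ
  rw [hd] at hC
  obtain ⟨A, hA⟩ := exists_lintegral_maximalFunction_rpow_le
    (volume : Measure (EuclideanSpace ℝ (Fin n))) hs
  set B : ℝ≥0 := max 1 A with hB
  have hB1 : 1 ≤ B := le_max_left _ _
  have hB0 : (B : ℝ≥0∞) ≠ 0 := by exact_mod_cast (zero_lt_one.trans_le hB1).ne'
  refine ⟨B * (4 * κ * C), fun f hf => ?_⟩
  have hfm := hf.aestronglyMeasurable
  set F : EuclideanSpace ℝ (Fin n) → ℝ≥0 := fun y => ‖hfm.mk f y‖₊ with hF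
  have hFm : Measurable F := hfm.stronglyMeasurable_mk.measurable.nnnorm
  have hFf : ∀ᵐ y, ‖f y‖ₑ = (F y : ℝ≥0∞) := by
    filter_upwards [hfm.ae_eq_mk] with y hy
    rw [hy]; rfl
  set N := eLpNorm f (ENNReal.ofReal s) volume with hN
  have hNt : N ≠ ∞ := hf.eLpNorm_ne_top
  have hNF : N = (∫⁻ y, (F y : ℝ≥0∞) ^ s) ^ (1 / s) := by
    rw [hN, eLpNorm_eq_lintegral_rpow_enorm_toReal (by simpa using hs0) ENNReal.ofReal_ne_top,
      ENNReal.toReal_ofReal hs0.le]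
    congr 1
    refine lintegral_congr_ae ?_
    filter_upwards [hFf] with y hy
    rw [hy]
  have hNs : N ^ s = ∫⁻ y, (F y : ℝ≥0∞) ^ s := by
    rw [hNF, ← ENNReal.rpow_mul, one_div_mul_cancel hs0.ne', ENNReal.rpow_one]
  set M := maximalFunction volume (fun y => (F y : ℝ≥0∞)) with hM
  set T := fun x => ∫⁻ y, ‖fracIntegrand ρ f x y‖ₑ with hT
  have hTle : ∀ x, ∀ r : ℝ, 0 < r →
      T x ≤ C * (cumulative ρ r * (M x + ENNReal.ofReal (1 / r ^ ((n : ℝ) / s)) * N)) := by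
    intro x r hr
    refine (lintegral_enorm_fracIntegrand_le hn hρ hFf x).trans ?_
    rw [hNF]
    exact hC _ hFm.coe_nnreal_ennreal x r hr
  have hIT : ∀ x, ‖fracIntegral ρ f x‖ₑ ≤ T x := fun x => enorm_integral_le_lintegral_enorm _
  have hFs : ∫⁻ y, (F y : ℝ≥0∞) ^ s ≠ ∞ := by
    rw [← hNs]; exact ENNReal.rpow_ne_top_of_nonneg hs0.le hNt
  have hmeas := (stronglyMeasurable_fracIntegral hρm hfm).aestronglyMeasurable (μ := volume)
  refine ⟨?_, ?_⟩
  · filter_upwards [ae_maximalFunction_lt_top volume hFm hs hFs] with x hx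
    refine ⟨aestronglyMeasurable_fracIntegrand hρm hfm x, (hTle x 1 one_pos).trans_lt ?_⟩
    have hR1 : cumulative ρ 1 ≠ ∞ := by
      have := hG.ne_top 1 one_pos
      simpa [profile] using this
    refine ENNReal.mul_lt_top ENNReal.coe_lt_top (ENNReal.mul_lt_top hR1.lt_top ?_)
    exact ENNReal.add_lt_top.2 ⟨hx, ENNReal.mul_lt_top ENNReal.ofReal_lt_top hNt.lt_top⟩
  rcases eq_or_ne N 0 with hN0 | hN0
  · have hf0 : f =ᵐ[volume] 0 := (eLpNorm_eq_zero_iff hfm (by simpa using hs0)).1 hN0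
    have hI : fracIntegral ρ f = 0 := by
      funext x
      refine integral_eq_zero_of_ae ?_
      filter_upwards [hf0] with y hy
      simp [fracIntegrand, hy]
    have hΨ0 : Ψ 0 = 0 := hG.isNFunction_young.map_zero
    refine ⟨⟨hmeas, 1, one_pos, ?_⟩, ?_⟩
    · simp [hI, hΨ0]
    · rw [hN0, mul_zero, nonpos_iff_eq_zero]
      refine le_antisymm (le_of_forall_gt fun a ha => ?_) zero_le
      obtain ⟨q, hq0, hqa⟩ := exists_between ha
      refine lt_of_le_of_lt (sInf_le ?_) hqa
      refine ⟨hq0, hqa.trans_le le_top, ?_⟩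
      simp [hI, hΨ0]
  set D : ℝ≥0∞ := (B : ℝ≥0∞) * (4 * κ * C) * N with hD
  have hκ0 : (κ : ℝ≥0∞) ≠ 0 := by exact_mod_cast (zero_lt_one.trans_le hG.one_le).ne'
  have hC0 : (C : ℝ≥0∞) ≠ 0 := by exact_mod_cast (zero_lt_one.trans_le hC1).ne'
  have hD0 : D ≠ 0 :=
    mul_ne_zero (mul_ne_zero hB0 (mul_ne_zero (mul_ne_zero (by norm_num) hκ0) hC0)) hN0
  have hDt : D ≠ ∞ := by rw [hD]; finiteness
  have hint : ∫⁻ x, Ψ (‖fracIntegral ρ f x‖ₑ / D) ≤ 1 := by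
    have hpt : ∀ x, Ψ (‖fracIntegral ρ f x‖ₑ / D) ≤ (B : ℝ≥0∞)⁻¹ * (M x / N) ^ s := by
      intro x
      have e : T x / D = (B : ℝ≥0∞)⁻¹ * (T x / (4 * κ * C * N)) := by
        rw [hD, mul_assoc, div_eq_mul_inv, div_eq_mul_inv,
          ENNReal.mul_inv (Or.inl hB0) (Or.inl ENNReal.coe_ne_top)]
        ring
      calc Ψ (‖fracIntegral ρ f x‖ₑ / D) ≤ Ψ (T x / D) :=
            monotone_youngOfInverse _ _ (ENNReal.div_le_div_right (hIT x) _)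
        _ ≤ (B : ℝ≥0∞)⁻¹ * Ψ (T x / (4 * κ * C * N)) := by
            rw [e]
            exact youngOfInverse_mul_le _ _ (ENNReal.inv_le_one.2 (by exact_mod_cast hB1)) _
        _ ≤ _ := by
            gcongr
            exact young_potential_le hs hn hG hC1 hN0 hNt (hTle x)
    have hNs0 : N ^ s ≠ 0 := by simp [ENNReal.rpow_eq_zero_iff, hN0, hNt]
    have hNst : N ^ s ≠ ∞ := ENNReal.rpow_ne_top_of_nonneg hs0.le hNt
    calc ∫⁻ x, Ψ (‖fracIntegral ρ f x‖ₑ / D)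
        ≤ ∫⁻ x, (B : ℝ≥0∞)⁻¹ * ((N ^ s)⁻¹ * M x ^ s) := by
          refine lintegral_mono fun x => (hpt x).trans_eq ?_
          rw [ENNReal.div_rpow_of_nonneg _ _ hs0.le, div_eq_mul_inv, mul_comm (M x ^ s)]
      _ = (B : ℝ≥0∞)⁻¹ * ((N ^ s)⁻¹ * ∫⁻ x, M x ^ s) := by
          rw [lintegral_const_mul' _ _ (ENNReal.inv_ne_top.2 hB0),
            lintegral_const_mul' _ _ (ENNReal.inv_ne_top.2 hNs0)]
      _ ≤ (B : ℝ≥0∞)⁻¹ * ((N ^ s)⁻¹ * (B * N ^ s)) := by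
          rw [hNs]
          gcongr
          refine (hA F hFm hFs).trans ?_
          gcongr
          exact le_max_right _ _
      _ = 1 := by
          rw [mul_left_comm _ (B : ℝ≥0∞), ← mul_assoc,
            ENNReal.inv_mul_cancel hB0 ENNReal.coe_ne_top,
            one_mul, ENNReal.inv_mul_cancel hNs0 hNst]
  refine ⟨⟨hmeas, (D⁻¹).toNNReal, ?_, ?_⟩, ?_⟩
  · exact ENNReal.toNNReal_pos (ENNReal.inv_ne_zero.2 hDt) (ENNReal.inv_ne_top.2 hD0)
  · rw [ENNReal.coe_toNNReal (ENNReal.inv_ne_top.2 hD0)]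
    refine lt_of_le_of_lt ?_ ENNReal.one_lt_top
    simpa only [div_eq_mul_inv, mul_comm] using hint
  · refine sInf_le ⟨?_, ?_, ?_⟩
    · push_cast
      exact pos_iff_ne_zero.2 hD0
    · push_cast
      exact hDt.lt_top
    · push_cast
      exact hint

end Operator
end OrliczFrac

theorem corollary3p5 (n : ℕ) (hn : 1 ≤ n) (s : ℝ) (hs : 1 < s)
    (ρ : ℝ → ℝ) (hρ_pos : ∀ r : ℝ, 0 < r → 0 < ρ r)
    (hρ_meas : AEMeasurable ρ (volume.restrict (Ioi (0 : ℝ))))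
    (hρ_int : ∫⁻ t in Ioo (0 : ℝ) 1, ENNReal.ofReal (ρ t / t) < ∞)
    (ε : ℝ) (hε : 0 < ε)
    (hρ_dec : OrliczFrac.AlmostDecreasing (fun r : ℝ => ρ r / r ^ ((n : ℝ) / s - ε))) :
    ∃ (Ψ : ℝ≥0∞ → ℝ≥0∞) (C : ℝ≥0), OrliczFrac.IsNFunction Ψ ∧ 0 < C ∧
      (∀ r : ℝ, 0 < r →
        (C : ℝ≥0∞)⁻¹ * OrliczFrac.genInverse Ψ (ENNReal.ofReal (1 / r ^ n)) ≤
            ENNReal.ofReal (1 / r ^ ((n : ℝ) / s)) *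
              ∫⁻ t in Ioo (0 : ℝ) r, ENNReal.ofReal (ρ t / t) ∧
        ENNReal.ofReal (1 / r ^ ((n : ℝ) / s)) *
              ∫⁻ t in Ioo (0 : ℝ) r, ENNReal.ofReal (ρ t / t) ≤
            (C : ℝ≥0∞) * OrliczFrac.genInverse Ψ (ENNReal.ofReal (1 / r ^ n))) ∧
      OrliczFrac.FracIntegralBounded n ρ s Ψ := by
  have hn0 : n ≠ 0 := by omega
  have hnr : (0 : ℝ) < n := by exact_mod_cast hn
  have : Nonempty (Fin n) := ⟨⟨0, hn⟩⟩
  obtain ⟨κ, hκ, hgrow⟩ := OrliczFrac.AlmostDecreasing.exists_growthBound hρ_pos hρ_dec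
  have hG : OrliczFrac.IsInverseProfile n (OrliczFrac.profile ρ (n / s)) κ :=
    hgrow.isInverseProfile hκ hρ_pos hρ_int hε (div_lt_self hnr hs)
  refine ⟨OrliczFrac.youngOfInverse n (OrliczFrac.profile ρ (n / s)), max 2 κ,
    hG.isNFunction_young, by positivity, fun r hr => ⟨?_, ?_⟩,
    OrliczFrac.fracIntegralBounded_young hs hε hn0 hρ_pos hρ_meas hgrow hG⟩
  · rw [ENNReal.inv_mul_le_iff (by simp) ENNReal.coe_ne_top]
    refine (hG.genInverse_young_le hr).trans (mul_le_mul_left ?_ _)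
    exact_mod_cast le_max_left _ _
  · refine (hG.le_mul_genInverse_young hr).trans (mul_le_mul_left ?_ _)
    exact_mod_cast le_max_right _ _
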